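/- All graphs are finite and simple. For a graph $G$ and $D \subseteq V(G)$, let $N[D]$ be the set of vertices that are in $D$ or have a neighbour in $D$, and let $\iota_2(G)$ be the size of a smallest set $D \subseteq V(G)$ such that $G - N[D]$ has no connected subgraph with at least $2$ edges. A leaf is a vertex of degree $1$; let $\ell(G)$ be the number of leaves of $G$. Let $\mathcal{S} = \{P_3, K_3, K_{1,3}, C_6, C_6', C_6''\}$, where $P_3$ is the path on $3$ vertices, $K_3$ is the triangle, $K_{1,3}$ is the star with $3$ leaves, $C_6$ is the cycle on $1,\dots,6$ (in this cyclic order), $C_6'$ is obtained from $C_6$ by adding a new vertex $7$ and the edge $\{1,7\}$, and $C_6''$ is obtained from $C_6'$ by adding the edge $\{3,5\}$. If $G$ is a connected graph with $n$ vertices and $r = \ell(G)$ leaves, and $G$ is not a copy of a graph in $\mathcal{S}$, then \[\iota_2(G) \leq \left\lfloor \frac{4n-r}{14} \right\rfloor .\] Moreover, the bound is attained by the following graphs. For $1 \leq n \leq 3$ let $B'_{n,P_3}$ be the path on $n$ vertices. For $n \geq 4$ let $a = \lfloor n/4 \rfloor$ and $b = n - 3a$ (so $a \le b \le a+3$), take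 the path $1, 2, \dots, a$ and pairwise disjoint $3$-vertex paths $F_1, \dots, F_a$ (disjoint from $\{1,\dots,b\}$), join $i$ to the middle vertex of $F_i$ for each $1 \leq i \leq a$, add the vertices $a+1, \dots, b$, and join $a$ to each of them; the resulting $n$-vertex graph is $B'_{n,P_3}$. For every $n \geq 1$ the graph $B'_{n,P_3}$ is connected; it is a copy of a graph in $\mathcal{S}$ exactly when $n \in \{3,4\}$; and if it is not a copy of a graph in $\mathcal{S}$, then \[\iota_2(B'_{n,P_3}) = \left\lfloor \frac{4n-\ell(B'_{n,P_3})}{14} \right\rfloor .\] -/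

import Mathlib

namespace GraphIsolation

universe u

/-- The closed neighbourhood `N[D]` of a set `D` of vertices of `G`. -/
def closedNeighborSet {V : Type u} (G : SimpleGraph V) (D : Set V) : Set V :=
  {v | ∃ u ∈ D, v = u ∨ G.Adj u v}

/-- `D` is an `𝓔ₖ`-isolating set of `G`, where `𝓔ₖ` is the class of connected graphs with at
least `k` edges: the graph `G - N[D]` has no connected subgraph with at least `k` edges. -/
def IsIsolating {V : Type u} (k : ℕ) (G : SimpleGraph V) (D : Set V) : Prop :=
  ∀ H : (G.induce (closedNeighborSet G D)ᶜ).Subgraph,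
    ¬ (H.Connected ∧ (k : ℕ∞) ≤ H.edgeSet.encard)

/-- The isolation number `ιₖ(G)`: the size of a smallest `𝓔ₖ`-isolating set of `G`. -/
noncomputable def isolationNumber {V : Type u} (k : ℕ) (G : SimpleGraph V) : ℕ :=
  sInf {m : ℕ | ∃ D : Finset V, IsIsolating k G (D : Set V) ∧ D.card = m}

/-- On a finite vertex set the infimum defining `ιₖ(G)` is attained. -/
theorem exists_isIsolating_card_eq {V : Type u} [Fintype V] (k : ℕ) (G : SimpleGraph V) :
    ∃ D : Finset V, IsIsolating k G (D : Set V) ∧ D.card = isolationNumber k G := by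
  have h : {m : ℕ | ∃ D : Finset V, IsIsolating k G (D : Set V) ∧ D.card = m}.Nonempty := by
    refine ⟨_, Finset.univ, ?_, rfl⟩
    rintro H ⟨hH, -⟩
    obtain ⟨⟨v, hv⟩, -⟩ := hH.nonempty
    exact hv ⟨v, by simp, Or.inl rfl⟩
  exact Nat.sInf_mem h

/-- The set of leaves of `G`: the vertices of degree `1`. -/
def leaves {V : Type u} (G : SimpleGraph V) : Set V :=
  {v | (G.neighborSet v).ncard = 1}

/-- The number of leaves of `G`. -/
noncomputable def leafCount {V : Type u} (G : SimpleGraph V) : ℕ :=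
  (leaves G).ncard

/-- The graph `C₆'`: the 6-cycle `0,1,2,3,4,5` together with a new vertex `6` joined to `0`. -/
def C6' : SimpleGraph (Fin 7) :=
  (SimpleGraph.cycleGraph 6).map Fin.castSucc ⊔ SimpleGraph.edge 0 6

/-- The graph `C₆''`: `C₆'` with the extra edge `{2, 4}`. -/
def C6'' : SimpleGraph (Fin 7) :=
  C6' ⊔ SimpleGraph.edge 2 4

/-- `G` is a copy of one of `P₃`, `K₃`, `K_{1,3}`, `C₆`, `C₆'`, `C₆''`. -/
def IsSGraph {V : Type u} (G : SimpleGraph V) : Prop :=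
  Nonempty (G ≃g SimpleGraph.pathGraph 3) ∨
  Nonempty (G ≃g (⊤ : SimpleGraph (Fin 3))) ∨
  Nonempty (G ≃g SimpleGraph.starGraph (0 : Fin 4)) ∨
  Nonempty (G ≃g SimpleGraph.cycleGraph 6) ∨
  Nonempty (G ≃g C6') ∨
  Nonempty (G ≃g C6'')

/-- The vertex set of `B'ₙ`: with `a = ⌊n/4⌋` and `b = n - 3a`, there are `b` base vertices
`0, …, b - 1` and, for each `i < a`, the three vertices `(i,0), (i,1), (i,2)` of `Fᵢ`. -/
abbrev BVert (n : ℕ) : Type :=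
  Fin (n - 3 * (n / 4)) ⊕ (Fin (n / 4) × Fin 3)

/-- The edges of `B'ₙ`, each listed in one direction. If `n ≤ 3`, the base vertices form a path
(and there are no other vertices). If `n ≥ 4`, the base vertices `i < a` form a path, the base
vertex `a - 1` is joined to all base vertices `j ≥ a`, each `Fᵢ` is the path
`(i,0), (i,1), (i,2)`, and the base vertex `i` is joined to the middle vertex `(i,1)`
of `Fᵢ`. -/
def BRel (n : ℕ) : BVert n → BVert n → Prop
  | Sum.inl i, Sum.inl j =>
      (n ≤ 3 ∧ (i : ℕ) + 1 = (j : ℕ)) ∨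
      (4 ≤ n ∧ (i : ℕ) + 1 = (j : ℕ) ∧ (j : ℕ) < n / 4) ∨
      (4 ≤ n ∧ (i : ℕ) + 1 = n / 4 ∧ n / 4 ≤ (j : ℕ))
  | Sum.inl i, Sum.inr (m, x) => (i : ℕ) = (m : ℕ) ∧ x = 1
  | Sum.inr (l, x), Sum.inr (m, y) => l = m ∧ (x : ℕ) + 1 = (y : ℕ)
  | Sum.inr _, Sum.inl _ => False

/-- The graph `B'ₙ` (that is, `B'_{n,P₃}`). -/
def BGraph (n : ℕ) : SimpleGraph (BVert n) :=
  SimpleGraph.fromRel (BRel n)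

/-- `B'ₙ` has exactly `n` vertices. -/
theorem card_BVert (n : ℕ) : Fintype.card (BVert n) = n := by
  simp only [Fintype.card_sum, Fintype.card_prod, Fintype.card_fin]
  omega

end GraphIsolation

/-! Give each leaf weight 3 and every other vertex weight 4, so that the whole graph weighs 4n - r.
The claim is that some isolating set D has 14|D| at most this weight. Take a minimal counterexample
G.

The engine is `wt_add_sum_lt`: if D₀ dominates X, then isolating sets of the components of G - X can
be added to D₀, so the weight of X plus the slack of all components is below 14|D₀|. Weights are
always measured in G. A leaf of G stays a leaf in any component with at least two vertices, so by
minimality a component satisfies the bound unless it is exceptional. An exceptional component that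
violates the bound does so by at most 4 (`exists_isolates_of_bad`), but it has slack 10 as soon as
one of its vertices with a neighbour outside is dominated (`exists_isolates_erase_of_bad`).

For X = {x} with x not a leaf, 4 + 10 = 14 shows that every component of G - x is good
(`goodSet_of_cut`). Hence each bad component of G - N[v] is attached to at least two neighbours of
v. For X = N[v] and D₀ = {v} ∪ A, three choices of A and a double count leave very few possibilities
when v has degree at least 3 (`structure_of_three_le_degree`): degree 3 with one bad component, or
degree 4 with two. This excludes leaves (`degree_ne_one`), then degree 4 (`degree_le_three`), then
degree 3 (`degree_le_two`); the surviving small configurations either have an explicit small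
isolating set or are exceptional themselves. So G is a cycle. There N[v] weighs only 12, but the
deletion creates new leaves in the remaining graph, and these supply the missing 2
(`exists_isolates_component`).

For sharpness, put a = ⌊n/4⌋. Each of the a paths Fᵢ forces its own vertex of D, and there are at
least 2a leaves, so 4n - r ≤ 14a + 12. -/

namespace GraphIsolation

universe u

/-! ### Isolation expressed through paths on three vertices -/

section Basics

variable {V : Type u} (G : SimpleGraph V)

/-- Some vertex of `D` is equal or adjacent to `v`. -/
def Dominates (D : Finset V) (v : V) : Prop := ∃ d ∈ D, v = d ∨ G.Adj d v

/-- Every path on three vertices inside `S` has a vertex dominated by `D`. -/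
def Isolates (S D : Finset V) : Prop :=
  ∀ a ∈ S, ∀ b ∈ S, ∀ c ∈ S, a ≠ c → G.Adj a b → G.Adj b c →
    Dominates G D a ∨ Dominates G D b ∨ Dominates G D c

variable {G}

theorem Dominates.mono {D D' : Finset V} {v : V} (h : Dominates G D v) (hD : D ⊆ D') :
    Dominates G D' v := by
  obtain ⟨d, hd, h⟩ := h
  exact ⟨d, hD hd, h⟩

theorem dominates_self {D : Finset V} {v : V} (h : v ∈ D) : Dominates G D v := ⟨v, h, Or.inl rfl⟩

theorem dominates_of_adj {D : Finset V} {v w : V} (h : v ∈ D) (hvw : G.Adj v w) :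
    Dominates G D w := ⟨v, h, Or.inr hvw⟩

theorem Isolates.mono {S S' D D' : Finset V} (h : Isolates G S D) (hS : S' ⊆ S) (hD : D ⊆ D') :
    Isolates G S' D' := fun a ha b hb c hc hac hab hbc => by
  rcases h a (hS ha) b (hS hb) c (hS hc) hac hab hbc with h | h | h
  · exact Or.inl (h.mono hD)
  · exact Or.inr (Or.inl (h.mono hD))
  · exact Or.inr (Or.inr (h.mono hD))

theorem isolates_of_card_le_two {S : Finset V} (h : S.card ≤ 2) (D : Finset V) :
    Isolates G S D := by
  classical
  intro a ha b hb c hc hac hab hbc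
  have : ({a, b, c} : Finset V) ⊆ S := by
    intro x hx
    simp only [Finset.mem_insert, Finset.mem_singleton] at hx
    rcases hx with rfl | rfl | rfl <;> assumption
  have h3 : ({a, b, c} : Finset V).card = 3 := by
    rw [Finset.card_eq_three]
    exact ⟨a, b, c, hab.ne, hac, hbc.ne, rfl⟩
  have := Finset.card_le_card this
  omega

theorem mem_closedNeighborSet_iff (D : Finset V) (v : V) :
    v ∈ closedNeighborSet G (D : Set V) ↔ Dominates G D v := by
  simp [closedNeighborSet, Dominates]

/-- A connected graph with no path on three vertices has at most one edge: once ab is an edge,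
nothing else can be reached from it. -/
theorem isIsolating_of_isolates [Fintype V] {D : Finset V} (h : Isolates G Finset.univ D) :
    IsIsolating 2 G (D : Set V) := by
  rintro H ⟨hc, he⟩
  have key : ∀ a b c, H.Adj a b → H.Adj b c → a = c := by
    intro a b c hab hbc
    by_contra hac
    have ha := a.2
    have hb := b.2
    have hcc := c.2
    rw [Set.mem_compl_iff, mem_closedNeighborSet_iff] at ha hb hcc
    have := h a (Finset.mem_univ _) b (Finset.mem_univ _) c (Finset.mem_univ _)
      (fun h => hac (Subtype.ext h)) (H.adj_sub hab) (H.adj_sub hbc)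
    tauto
  have hne : H.edgeSet.Nonempty := by
    rw [Set.nonempty_iff_ne_empty]
    intro h0
    rw [h0] at he
    simp at he
  obtain ⟨e, he'⟩ := hne
  induction e using Sym2.ind with
  | _ a b =>
    rw [SimpleGraph.Subgraph.mem_edgeSet] at he'
    have hclosed : ∀ v : H.verts, (v : _) = a ∨ (v : _) = b := by
      intro v
      have hr := hc.preconnected ⟨a, he'.fst_mem⟩ v
      rw [SimpleGraph.reachable_iff_reflTransGen] at hr
      induction hr with
      | refl => exact Or.inl rfl
      | tail _ h2 ih =>
        rename_i p q _
        have h2' : H.Adj p.1 q.1 := h2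
        rcases ih with ih | ih
        · rw [ih] at h2'
          exact Or.inr (key _ _ _ h2'.symm he')
        · rw [ih] at h2'
          exact Or.inl (key _ _ _ h2'.symm he'.symm)
    have hsub : H.edgeSet ⊆ {s(a, b)} := by
      intro e hee
      induction e using Sym2.ind with
      | _ p q =>
        rw [SimpleGraph.Subgraph.mem_edgeSet] at hee
        have hp := hclosed ⟨p, hee.fst_mem⟩
        have hq := hclosed ⟨q, hee.snd_mem⟩
        have hne := hee.ne
        simp only at hp hq
        rcases hp with rfl | rfl <;> rcases hq with rfl | rfl
        · exact absurd rfl hne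
        · rfl
        · exact Sym2.eq_swap
        · exact absurd rfl hne
    have := Set.encard_le_encard hsub
    rw [Set.encard_singleton] at this
    have h21 : ((2 : ℕ) : ℕ∞) ≤ 1 := he.trans this
    exact absurd h21 (by norm_num)

/-- The two edges of an undominated path on three vertices form a forbidden connected subgraph. -/
theorem isolates_of_isIsolating [Fintype V] {D : Finset V} (h : IsIsolating 2 G (D : Set V)) :
    Isolates G Finset.univ D := by
  intro a _ b _ c _ hac hab hbc
  by_contra hcon
  push Not at hcon
  obtain ⟨ha, hb, hc⟩ := hcon
  rw [← mem_closedNeighborSet_iff] at ha hb hc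
  set K := G.induce (closedNeighborSet G (D : Set V))ᶜ
  have h1 : K.Adj ⟨a, ha⟩ ⟨b, hb⟩ := hab
  have h2 : K.Adj ⟨b, hb⟩ ⟨c, hc⟩ := hbc
  refine h (K.subgraphOfAdj h1 ⊔ K.subgraphOfAdj h2) ⟨?_, ?_⟩
  · refine SimpleGraph.Subgraph.connected_sup
      (SimpleGraph.Subgraph.subgraphOfAdj_connected h1).preconnected
      (SimpleGraph.Subgraph.subgraphOfAdj_connected h2).preconnected ⟨⟨b, hb⟩, ?_⟩
    simp
  · rw [SimpleGraph.Subgraph.edgeSet_sup, SimpleGraph.edgeSet_subgraphOfAdj,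
      SimpleGraph.edgeSet_subgraphOfAdj, Set.singleton_union, Set.encard_pair]
    · rfl
    · intro h
      rw [Sym2.eq_iff] at h
      simp only [Subtype.mk.injEq] at h
      rcases h with ⟨h, -⟩ | ⟨h, -⟩
      · exact hab.ne h
      · exact hac h

theorem isolationNumber_le [Fintype V] {D : Finset V} (h : Isolates G Finset.univ D) :
    isolationNumber 2 G ≤ D.card :=
  Nat.sInf_le ⟨D, isIsolating_of_isolates h, rfl⟩

end Basics

/-! ### Components of G - X -/

section Components

variable {V : Type u} (G : SimpleGraph V)

/-- `C` is nonempty and no proper nonempty subset of `C` is closed under adjacency within `C`. -/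
def Conn (C : Finset V) : Prop :=
  C.Nonempty ∧ ∀ S ⊆ C, S.Nonempty → (∀ s ∈ S, ∀ c ∈ C, G.Adj s c → c ∈ S) → S = C

/-- `C` is the vertex set of a component of `G - X`. -/
structure IsComp (X C : Finset V) : Prop where
  conn : Conn G C
  notMem : ∀ c ∈ C, c ∉ X
  closed : ∀ c ∈ C, ∀ w, G.Adj c w → w ∈ C ∨ w ∈ X

variable {G}

theorem Conn.connected_induce {C : Finset V} (h : Conn G C) :
    (G.induce (C : Set V)).Connected := by
  classical
  obtain ⟨⟨c₀, hc₀⟩, hS⟩ := h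
  have : Nonempty (C : Set V) := ⟨⟨c₀, hc₀⟩⟩
  refine ⟨fun x y => ?_⟩
  have := hS (C.filter fun z => ∃ hz : z ∈ C, (G.induce (C : Set V)).Reachable x ⟨z, hz⟩)
    (Finset.filter_subset _ _) ⟨x, by simp⟩ (by
      intro s hs c hc hsc
      rw [Finset.mem_filter] at hs ⊢
      obtain ⟨-, hsC, hr⟩ := hs
      have : (G.induce (C : Set V)).Adj ⟨s, hsC⟩ ⟨c, hc⟩ := hsc
      exact ⟨hc, hc, hr.trans this.reachable⟩)
  have hy : (y : V) ∈ C := y.2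
  have hy' := (Finset.ext_iff.1 this y).2 hy
  obtain ⟨-, _, hr⟩ := Finset.mem_filter.1 hy'
  exact hr

theorem eq_univ_of_closed [Fintype V] (hG : G.Connected) {S : Finset V} (hne : S.Nonempty)
    (hS : ∀ s ∈ S, ∀ w, G.Adj s w → w ∈ S) : S = Finset.univ := by
  obtain ⟨s, hs⟩ := hne
  refine Finset.eq_univ_iff_forall.2 fun v => ?_
  have hr := hG.preconnected s v
  rw [SimpleGraph.reachable_iff_reflTransGen] at hr
  induction hr with
  | refl => exact hs
  | tail _ h2 ih => exact hS _ ih _ h2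

theorem IsComp.eq_of_mem {X C C' : Finset V} (h : IsComp G X C) (h' : IsComp G X C') {v : V}
    (hv : v ∈ C) (hv' : v ∈ C') : C = C' := by
  classical
  have aux : ∀ {A B : Finset V}, IsComp G X A → IsComp G X B → v ∈ A → v ∈ B → A ∩ B = A := by
    intro A B hA hB hvA hvB
    refine hA.conn.2 _ Finset.inter_subset_left ⟨v, by simp [hvA, hvB]⟩ ?_
    intro s hs c hc hsc
    rw [Finset.mem_inter] at hs ⊢
    exact ⟨hc, (hB.closed s hs.2 c hsc).resolve_right (hA.notMem c hc)⟩
  rw [← aux h h' hv hv', Finset.inter_comm]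
  exact aux h' h hv' hv

theorem exists_isComp [Fintype V] (X : Finset V) {v : V} (hv : v ∉ X) :
    ∃ C, IsComp G X C ∧ v ∈ C := by
  classical
  set R : V → V → Prop := fun a b => G.Adj a b ∧ a ∉ X ∧ b ∉ X
  have hsymm : Std.Symm R := ⟨fun a b h => ⟨h.1.symm, h.2.2, h.2.1⟩⟩
  set C : Finset V := Finset.univ.filter fun w => Relation.ReflTransGen R v w with hC
  have hmem : ∀ w, w ∈ C ↔ Relation.ReflTransGen R v w := by simp [hC]
  have hX : ∀ c ∈ C, c ∉ X := by
    intro c hc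
    rw [hmem] at hc
    cases hc with
    | refl => exact hv
    | tail _ h => exact h.2.2
  refine ⟨C, ⟨⟨⟨v, (hmem v).2 .refl⟩, ?_⟩, hX, ?_⟩, (hmem v).2 .refl⟩
  · intro S hS ⟨s, hs⟩ hcl
    have hstep : ∀ a b, a ∈ S → Relation.ReflTransGen R a b → b ∈ S := by
      intro a b ha hab
      induction hab with
      | refl => exact ha
      | tail _ h2 ih =>
        exact hcl _ ih _ ((hmem _).2 (((hmem _).1 (hS ih)).tail h2)) h2.1
    have hvs : v ∈ S := hstep s v hs
      (by
        have := (hmem s).1 (hS hs)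
        exact Std.Symm.symm (r := Relation.ReflTransGen R) _ _ this)
    exact Finset.Subset.antisymm hS fun c hc => hstep v c hvs ((hmem c).1 hc)
  · intro c hc w hcw
    by_cases hw : w ∈ X
    · exact Or.inr hw
    · exact Or.inl ((hmem w).2 (((hmem c).1 hc).tail ⟨hcw, hX c hc, hw⟩))

theorem IsComp.exists_adj [Fintype V] (hG : G.Connected) {X C : Finset V} (h : IsComp G X C)
    (hX : X.Nonempty) : ∃ c ∈ C, ∃ x ∈ X, G.Adj c x := by
  by_contra hcon
  push Not at hcon
  have := eq_univ_of_closed hG h.conn.1 (fun s hs w hsw =>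
    (h.closed s hs w hsw).resolve_right fun hw => hcon s hs w hw hsw)
  obtain ⟨x, hx⟩ := hX
  exact h.notMem x (this ▸ Finset.mem_univ x) hx

open scoped Classical in
/-- The vertex sets of the components of `G - X`. -/
noncomputable def comps [Fintype V] (G : SimpleGraph V) (X : Finset V) : Finset (Finset V) :=
  Finset.univ.filter (IsComp G X)

theorem mem_comps [Fintype V] {X C : Finset V} : C ∈ comps G X ↔ IsComp G X C := by
  simp [comps]

end Components

/-! ### Weights and the combination of isolating sets -/

section Weights

open scoped Classical

variable {V : Type u} [Fintype V] (G : SimpleGraph V)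

/-- Leaves have weight `3`, all other vertices have weight `4`. -/
noncomputable def vwt (v : V) : ℤ := if G.degree v = 1 then 3 else 4

/-- The total weight of a set of vertices. -/
noncomputable def wt (C : Finset V) : ℤ := ∑ v ∈ C, vwt G v

/-- Some set isolating `C` has at most a fourteenth of the weight of `C` many elements. -/
def GoodSet (C : Finset V) : Prop := ∃ D, Isolates G C D ∧ 14 * (D.card : ℤ) ≤ wt G C

variable {G}

theorem three_le_vwt (v : V) : 3 ≤ vwt G v := by unfold vwt; split_ifs <;> norm_num

theorem vwt_of_degree_ne_one {v : V} (h : G.degree v ≠ 1) : vwt G v = 4 := if_neg h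

theorem vwt_of_degree_eq_one {v : V} (h : G.degree v = 1) : vwt G v = 3 := if_pos h

theorem degree_ne_one_of_adj {v a b : V} (ha : G.Adj v a) (hb : G.Adj v b) (hab : a ≠ b) :
    G.degree v ≠ 1 := by
  intro h
  rw [← SimpleGraph.card_neighborFinset_eq_degree, Finset.card_eq_one] at h
  obtain ⟨w, hw⟩ := h
  have h1 : a ∈ G.neighborFinset v := by simpa using ha
  have h2 : b ∈ G.neighborFinset v := by simpa using hb
  rw [hw, Finset.mem_singleton] at h1 h2
  exact hab (h1.trans h2.symm)

theorem vwt_of_adj {v a b : V} (ha : G.Adj v a) (hb : G.Adj v b) (hab : a ≠ b) : vwt G v = 4 :=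
  vwt_of_degree_ne_one (degree_ne_one_of_adj ha hb hab)

theorem three_mul_card_le_wt (C : Finset V) : 3 * (C.card : ℤ) ≤ wt G C := by
  have := Finset.card_nsmul_le_sum C (vwt G) 3 (fun v _ => three_le_vwt v)
  rw [nsmul_eq_mul] at this
  unfold wt
  linarith

theorem wt_nonneg (C : Finset V) : 0 ≤ wt G C := by
  have := three_mul_card_le_wt (G := G) C
  omega

theorem wt_univ_eq_add_sum_comps (X : Finset V) :
    wt G Finset.univ = wt G X + ∑ C ∈ comps G X, wt G C := by
  have h1 : (comps G X).biUnion id = Xᶜ := by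
    ext v
    simp only [Finset.mem_biUnion, id, mem_comps, Finset.mem_compl]
    exact ⟨fun ⟨C, hC, hv⟩ => hC.notMem v hv, fun hv => exists_isComp X hv⟩
  have h2 : ∑ C ∈ comps G X, wt G C = wt G Xᶜ := by
    rw [← h1]
    unfold wt
    rw [Finset.sum_biUnion]
    · rfl
    · intro C hC C' hC' hne
      rw [Finset.mem_coe, mem_comps] at hC hC'
      exact Finset.disjoint_left.2 fun v hv hv' => hne (hC.eq_of_mem hC' hv hv')
  rw [h2]
  exact (Finset.sum_add_sum_compl X _).symm

/-- Isolating sets of the components of `G - X`, where `X` is dominated by `D₀`, combine. -/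
theorem wt_add_sum_lt (hG : ¬ GoodSet G Finset.univ) (X D₀ : Finset V)
    (hX : ∀ x ∈ X, Dominates G D₀ x) (σ : Finset V → ℤ)
    (hσ : ∀ C, IsComp G X C → ∃ D, Isolates G (C.filter fun c => ¬ Dominates G D₀ c) D ∧
      14 * (D.card : ℤ) + σ C ≤ wt G C) :
    wt G X + ∑ C ∈ comps G X, σ C < 14 * D₀.card := by
  by_contra hcon
  push Not at hcon
  choose! D hD hcard using hσ
  refine hG ⟨D₀ ∪ (comps G X).biUnion D, ?_, ?_⟩
  · intro a _ b _ c _ hac hab hbc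
    by_contra hdom
    push Not at hdom
    obtain ⟨ha, hb, hc⟩ := hdom
    have h0 : ∀ {w}, ¬ Dominates G (D₀ ∪ (comps G X).biUnion D) w → ¬ Dominates G D₀ w :=
      fun h h' => h (h'.mono Finset.subset_union_left)
    have hX' : ∀ {w}, ¬ Dominates G (D₀ ∪ (comps G X).biUnion D) w → w ∉ X :=
      fun h h' => h0 h (hX _ h')
    -- A path avoiding N[D₀] avoids X as well, so it lies inside the component of its middle vertex.
    obtain ⟨C, hC, hbC⟩ := exists_isComp X (hX' hb)
    have haC := (hC.closed b hbC a hab.symm).resolve_right (hX' ha)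
    have hcC := (hC.closed b hbC c hbc).resolve_right (hX' hc)
    have hsub : D C ⊆ D₀ ∪ (comps G X).biUnion D :=
      (Finset.subset_biUnion_of_mem D (mem_comps.2 hC)).trans Finset.subset_union_right
    rcases hD C hC a (Finset.mem_filter.2 ⟨haC, h0 ha⟩) b (Finset.mem_filter.2 ⟨hbC, h0 hb⟩) c
      (Finset.mem_filter.2 ⟨hcC, h0 hc⟩) hac hab hbc with h | h | h
    · exact ha (h.mono hsub)
    · exact hb (h.mono hsub)
    · exact hc (h.mono hsub)
  · have h1 : ((D₀ ∪ (comps G X).biUnion D).card : ℤ) ≤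
        D₀.card + ∑ C ∈ comps G X, ((D C).card : ℤ) := by
      have := (Finset.card_union_le D₀ ((comps G X).biUnion D)).trans
        (Nat.add_le_add_left Finset.card_biUnion_le _)
      exact_mod_cast this
    have h2 : ∑ C ∈ comps G X, (14 * ((D C).card : ℤ) + σ C) ≤ ∑ C ∈ comps G X, wt G C :=
      Finset.sum_le_sum fun C hC => hcard C (mem_comps.1 hC)
    rw [Finset.sum_add_distrib, ← Finset.mul_sum] at h2
    rw [wt_univ_eq_add_sum_comps X]
    linarith

end Weights

end GraphIsolation

namespace GraphIsolation

universe u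

/-! ### Exceptional components: deficit and slack -/

section Labellings

open scoped Classical

variable {V : Type u} {G : SimpleGraph V}

/-- `f` is an isomorphism from the graph with adjacency `R` to the subgraph of `G` induced
by `C`. -/
structure Labelling (G : SimpleGraph V) (C : Finset V) {k : ℕ} (R : Fin k → Fin k → Bool)
    (f : Fin k → V) : Prop where
  inj : Function.Injective f
  image : C = Finset.univ.image f
  adj : ∀ i j, G.Adj (f i) (f j) ↔ R i j = true

theorem exists_labelling {C : Finset V} {k : ℕ} {Γ : SimpleGraph (Fin k)}
    (e : G.induce (C : Set V) ≃g Γ) (R : Fin k → Fin k → Bool)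
    (hR : ∀ i j, Γ.Adj i j ↔ R i j = true) : ∃ f, Labelling G C R f := by
  refine ⟨fun i => (e.symm i : V), fun i j h => e.symm.injective (Subtype.ext h), ?_, ?_⟩
  · ext v
    simp only [Finset.mem_image, Finset.mem_univ, true_and]
    constructor
    · intro hv
      exact ⟨e ⟨v, hv⟩, by simp⟩
    · rintro ⟨i, rfl⟩
      exact (e.symm i).2
  · intro i j
    rw [← hR]
    exact e.symm.map_adj_iff (v := i) (w := j)

theorem Labelling.nonempty_iso [Fintype V] {k : ℕ} {R : Fin k → Fin k → Bool} {f : Fin k → V}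
    (h : Labelling G Finset.univ R f) {Γ : SimpleGraph (Fin k)}
    (hR : ∀ i j, Γ.Adj i j ↔ R i j = true) : Nonempty (G ≃g Γ) := by
  have hs : Function.Surjective f := fun v => by
    have := h.image ▸ Finset.mem_univ v
    simpa using this
  refine ⟨(RelIso.symm ⟨Equiv.ofBijective f ⟨h.inj, hs⟩, ?_⟩)⟩
  intro i j
  rw [hR]
  exact h.adj i j

theorem Labelling.mem {C : Finset V} {k : ℕ} {R : Fin k → Fin k → Bool} {f : Fin k → V}
    (h : Labelling G C R f) (i : Fin k) : f i ∈ C := by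
  rw [h.image]
  exact Finset.mem_image_of_mem _ (Finset.mem_univ _)

theorem Labelling.exists_eq {C : Finset V} {k : ℕ} {R : Fin k → Fin k → Bool} {f : Fin k → V}
    (h : Labelling G C R f) {v : V} (hv : v ∈ C) : ∃ i, f i = v := by
  rw [h.image] at hv
  simpa using hv

theorem Labelling.card {C : Finset V} {k : ℕ} {R : Fin k → Fin k → Bool} {f : Fin k → V}
    (h : Labelling G C R f) : C.card = k := by
  rw [h.image, Finset.card_image_of_injective _ h.inj, Finset.card_univ, Fintype.card_fin]

/-- Moves isolation to the index graph `R`, where it becomes a finite check. -/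
theorem Labelling.isolates_image {C : Finset V} {k : ℕ} {R : Fin k → Fin k → Bool} {f : Fin k → V}
    (hf : Labelling G C R f) (S D : Finset (Fin k))
    (h : ∀ a ∈ S, ∀ b ∈ S, ∀ c ∈ S, a ≠ c → R a b = true → R b c = true →
      (∃ d ∈ D, a = d ∨ R d a = true) ∨ (∃ d ∈ D, b = d ∨ R d b = true) ∨
      (∃ d ∈ D, c = d ∨ R d c = true)) :
    Isolates G (S.image f) (D.image f) := by
  have hdom : ∀ a, (∃ d ∈ D, a = d ∨ R d a = true) → Dominates G (D.image f) (f a) := by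
    rintro a ⟨d, hd, rfl | h⟩
    · exact dominates_self (Finset.mem_image_of_mem f hd)
    · exact dominates_of_adj (Finset.mem_image_of_mem f hd) ((hf.adj _ _).2 h)
  intro a ha b hb c hc hac hab hbc
  obtain ⟨a, ha', rfl⟩ := Finset.mem_image.1 ha
  obtain ⟨b, hb', rfl⟩ := Finset.mem_image.1 hb
  obtain ⟨c, hc', rfl⟩ := Finset.mem_image.1 hc
  rcases h a ha' b hb' c hc' (fun h => hac (congrArg f h)) ((hf.adj _ _).1 hab)
    ((hf.adj _ _).1 hbc) with h | h | h
  · exact Or.inl (hdom _ h)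
  · exact Or.inr (Or.inl (hdom _ h))
  · exact Or.inr (Or.inr (hdom _ h))

theorem Labelling.isolates {C : Finset V} {k : ℕ} {R : Fin k → Fin k → Bool} {f : Fin k → V}
    (hf : Labelling G C R f) (D : Finset (Fin k))
    (h : ∀ a b c, a ≠ c → R a b = true → R b c = true →
      (∃ d ∈ D, a = d ∨ R d a = true) ∨ (∃ d ∈ D, b = d ∨ R d b = true) ∨
      (∃ d ∈ D, c = d ∨ R d c = true)) :
    Isolates G C (D.image f) := by
  rw [hf.image]
  exact hf.isolates_image _ _ fun a _ b _ c _ => h a b c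

theorem Labelling.isolates_erase {C : Finset V} {k : ℕ} {R : Fin k → Fin k → Bool}
    {f : Fin k → V} (hf : Labelling G C R f) (y : Fin k) (D : Finset (Fin k))
    (h : ∀ a b c, a ≠ y → b ≠ y → c ≠ y → a ≠ c → R a b = true → R b c = true →
      (∃ d ∈ D, a = d ∨ R d a = true) ∨ (∃ d ∈ D, b = d ∨ R d b = true) ∨
      (∃ d ∈ D, c = d ∨ R d c = true)) :
    Isolates G (C.erase (f y)) (D.image f) := by
  rw [hf.image, ← Finset.image_erase hf.inj]
  exact hf.isolates_image _ _ fun a ha b hb c hc =>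
    h a b c (Finset.ne_of_mem_erase ha) (Finset.ne_of_mem_erase hb) (Finset.ne_of_mem_erase hc)

theorem Labelling.wt_eq [Fintype V] {C : Finset V} {k : ℕ} {R : Fin k → Fin k → Bool}
    {f : Fin k → V} (hf : Labelling G C R f) : wt G C = ∑ i, vwt G (f i) := by
  rw [hf.image, wt, Finset.sum_image hf.inj.injOn]

theorem Labelling.vwt_eq_four [Fintype V] {C : Finset V} {k : ℕ} {R : Fin k → Fin k → Bool}
    {f : Fin k → V} (hf : Labelling G C R f) (i a b : Fin k) (ha : R i a = true)
    (hb : R i b = true) (hab : a ≠ b) : vwt G (f i) = 4 :=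
  vwt_of_adj ((hf.adj _ _).2 ha) ((hf.adj _ _).2 hb) (hf.inj.ne hab)

theorem Labelling.degree_ne_one [Fintype V] {C : Finset V} {k : ℕ} {R : Fin k → Fin k → Bool}
    {f : Fin k → V} (hf : Labelling G C R f) (i a : Fin k) (ha : R i a = true) {w : V}
    (hw : w ∉ C) (hiw : G.Adj (f i) w) : G.degree (f i) ≠ 1 :=
  degree_ne_one_of_adj hiw ((hf.adj _ _).2 ha) fun h => hw (h ▸ hf.mem a)

/-- Adjacency in the path on three vertices. -/
def adjP3 (i j : Fin 3) : Bool := decide (i ≠ j ∧ (i = 1 ∨ j = 1))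

/-- Adjacency in the triangle. -/
def adjK3 (i j : Fin 3) : Bool := decide (i ≠ j)

/-- Adjacency in the star with three leaves. -/
def adjStar (i j : Fin 4) : Bool := decide (i ≠ j ∧ (i = 0 ∨ j = 0))

/-- Adjacency in the cycle on six vertices. -/
def adjHex (i j : Fin 6) : Bool := decide (j = i + 1 ∨ i = j + 1)

/-- Adjacency in `C₆'`. -/
def adjC6' (i j : Fin 7) : Bool :=
  decide (i ≠ 6 ∧ j ≠ 6 ∧ ((i : ℕ) + 1 = j ∨ (j : ℕ) + 1 = i ∨ (i = 0 ∧ j = 5) ∨ (i = 5 ∧ j = 0)) ∨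
    (i = 0 ∧ j = 6) ∨ (i = 6 ∧ j = 0))

/-- Adjacency in `C₆''`. -/
def adjC6'' (i j : Fin 7) : Bool :=
  adjC6' i j || decide ((i = 2 ∧ j = 4) ∨ (i = 4 ∧ j = 2))

theorem pathGraph_three_adj (i j : Fin 3) :
    (SimpleGraph.pathGraph 3).Adj i j ↔ adjP3 i j = true := by
  rw [SimpleGraph.pathGraph_adj]
  revert i j; decide

theorem top_three_adj (i j : Fin 3) : (⊤ : SimpleGraph (Fin 3)).Adj i j ↔ adjK3 i j = true := by
  simp [adjK3]

theorem starGraph_four_adj (i j : Fin 4) :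
    (SimpleGraph.starGraph (0 : Fin 4)).Adj i j ↔ adjStar i j = true := by
  simp [SimpleGraph.starGraph_adj, adjStar]

theorem cycleGraph_six_adj (i j : Fin 6) :
    (SimpleGraph.cycleGraph 6).Adj i j ↔ adjHex i j = true := by
  rw [SimpleGraph.cycleGraph_adj]
  revert i j; decide

theorem C6'_adj (i j : Fin 7) : C6'.Adj i j ↔ adjC6' i j = true := by
  simp only [C6', SimpleGraph.sup_adj, SimpleGraph.edge_adj]
  revert i j; decide

theorem C6''_adj (i j : Fin 7) : C6''.Adj i j ↔ adjC6'' i j = true := by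
  simp only [C6'', SimpleGraph.sup_adj, SimpleGraph.edge_adj, C6'_adj]
  revert i j; decide

/-- `C` consists of three vertices spanning a path. -/
def Trio (G : SimpleGraph V) (C : Finset V) : Prop :=
  ∃ a b c, G.Adj a b ∧ G.Adj b c ∧ a ≠ c ∧ C = {a, b, c}

/-- `C` induces a cycle on six vertices. -/
def Hex (G : SimpleGraph V) (C : Finset V) : Prop := ∃ f, Labelling G C adjHex f

theorem card_image_singleton_fin {k : ℕ} (f : Fin k → V) (i : Fin k) :
    ((({i} : Finset (Fin k)).image f).card : ℤ) = 1 := by simp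

theorem card_image_pair_le {k : ℕ} (f : Fin k → V) (i j : Fin k) :
    ((({i, j} : Finset (Fin k)).image f).card : ℤ) ≤ 2 := by
  exact_mod_cast Finset.card_image_le.trans Finset.card_le_two

theorem Trio.card {C : Finset V} (h : Trio G C) : C.card = 3 := by
  obtain ⟨a, b, c, hab, hbc, hac, rfl⟩ := h
  rw [Finset.card_eq_three]
  exact ⟨a, b, c, hab.ne, hac, hbc.ne, rfl⟩

theorem Trio.isolates {C : Finset V} (h : Trio G C) :
    ∃ D, Isolates G C D ∧ D.card = 1 := by
  obtain ⟨a, b, c, hab, hbc, hac, rfl⟩ := h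
  refine ⟨{b}, ?_, by simp⟩
  intro x hx y hy z hz hxz _ _
  left
  simp only [Finset.mem_insert, Finset.mem_singleton] at hx
  rcases hx with rfl | rfl | rfl
  · exact dominates_of_adj (by simp) hab.symm
  · exact dominates_self (by simp)
  · exact dominates_of_adj (by simp) hbc

variable [Fintype V]

/-- `C` contains a leaf, its isolation number exceeds the desired bound by at most `1 / 14`, and
it drops when a vertex having a neighbour outside is removed. -/
structure LeafyBad (G : SimpleGraph V) (C : Finset V) : Prop where
  leaf : ∃ v ∈ C, G.degree v = 1
  isol : ∃ D, Isolates G C D ∧ 14 * (D.card : ℤ) ≤ wt G C + 1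
  erase : ∀ y ∈ C, ∀ w ∉ C, G.Adj y w →
    ∃ D, Isolates G (C.erase y) D ∧ 14 * (D.card : ℤ) + 10 ≤ wt G C

/-- The centre alone isolates the star, and the weight is below 14 only if all three ends are leaves
of G, when it is 13. In that case only the centre can have a neighbour outside, and deleting it
leaves no edge. -/
theorem Labelling.star {C : Finset V} {f : Fin 4 → V} (hf : Labelling G C adjStar f) :
    GoodSet G C ∨ LeafyBad G C := by
  have hw := hf.wt_eq
  have h0 := hf.vwt_eq_four 0 1 2 (by decide) (by decide) (by decide)
  rw [Fin.sum_univ_four, h0] at hw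
  have hiso : Isolates G C (({0} : Finset (Fin 4)).image f) := hf.isolates _ (by decide)
  by_cases hl : G.degree (f 1) = 1 ∧ G.degree (f 2) = 1 ∧ G.degree (f 3) = 1
  · obtain ⟨h1, h2, h3⟩ := hl
    rw [vwt_of_degree_eq_one h1, vwt_of_degree_eq_one h2, vwt_of_degree_eq_one h3] at hw
    refine Or.inr ⟨⟨f 1, hf.mem 1, h1⟩, ⟨_, hiso, ?_⟩, ?_⟩
    · rw [card_image_singleton_fin, hw]
      norm_num
    · intro y hy w hwC hyw
      obtain ⟨i, rfl⟩ := hf.exists_eq hy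
      have hi : i = 0 := by
        by_contra hi
        have := hf.degree_ne_one i 0 (by clear * - hi; revert i; decide) hwC hyw
        have : i = 1 ∨ i = 2 ∨ i = 3 := by revert hi; clear * -; revert i; decide
        rcases this with rfl | rfl | rfl <;> contradiction
      subst hi
      refine ⟨_, hf.isolates_erase 0 ∅ (by decide), ?_⟩
      rw [hw]
      simp
  · left
    refine ⟨_, hiso, ?_⟩
    rw [card_image_singleton_fin, hw]
    have h1 := three_le_vwt (G := G) (f 1)
    have h2 := three_le_vwt (G := G) (f 2)
    have h3 := three_le_vwt (G := G) (f 3)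
    by_cases k1 : G.degree (f 1) = 1
    · by_cases k2 : G.degree (f 2) = 1
      · have := vwt_of_degree_ne_one fun k3 => hl ⟨k1, k2, k3⟩
        linarith
      · have := vwt_of_degree_ne_one k2
        linarith
    · have := vwt_of_degree_ne_one k1
      linarith

/-- Common treatment of C₆' and C₆''. The six cycle vertices weigh 24 and the pair `{0, 3}`
isolates, so the bound fails by one exactly when the pendant vertex is a leaf of G. The vertex `t y`
isolates what remains after deletion of `y`, giving 14 + 10 ≤ 27. -/
theorem Labelling.seven {C : Finset V} {R : Fin 7 → Fin 7 → Bool} {f : Fin 7 → V}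
    (hf : Labelling G C R f) (hadj : ∀ i : Fin 7, i ≠ 6 → ∃ a b, R i a = true ∧ R i b = true ∧ a ≠ b)
    (h6 : R 6 0 = true)
    (hpair : ∀ a b c, a ≠ c → R a b = true → R b c = true →
      (∃ d ∈ ({0, 3} : Finset (Fin 7)), a = d ∨ R d a = true) ∨
      (∃ d ∈ ({0, 3} : Finset (Fin 7)), b = d ∨ R d b = true) ∨
      (∃ d ∈ ({0, 3} : Finset (Fin 7)), c = d ∨ R d c = true))
    (t : Fin 7 → Fin 7)
    (ht : ∀ y, y ≠ 6 → ∀ a b c, a ≠ y → b ≠ y → c ≠ y → a ≠ c → R a b = true → R b c = true →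
      (∃ d ∈ ({t y} : Finset (Fin 7)), a = d ∨ R d a = true) ∨
      (∃ d ∈ ({t y} : Finset (Fin 7)), b = d ∨ R d b = true) ∨
      (∃ d ∈ ({t y} : Finset (Fin 7)), c = d ∨ R d c = true)) :
    GoodSet G C ∨ LeafyBad G C := by
  have hw := hf.wt_eq
  have h4 : ∀ i : Fin 7, i ≠ 6 → vwt G (f i) = 4 := fun i hi => by
    obtain ⟨a, b, ha, hb, hab⟩ := hadj i hi
    exact hf.vwt_eq_four i a b ha hb hab
  rw [Fin.sum_univ_seven, h4 0 (by decide), h4 1 (by decide), h4 2 (by decide), h4 3 (by decide),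
    h4 4 (by decide), h4 5 (by decide)] at hw
  have hiso := hf.isolates _ hpair
  have hcard := card_image_pair_le f 0 3
  by_cases hl : G.degree (f 6) = 1
  · rw [vwt_of_degree_eq_one hl] at hw
    refine Or.inr ⟨⟨f 6, hf.mem 6, hl⟩, ⟨_, hiso, ?_⟩, ?_⟩
    · rw [hw]
      linarith
    · intro y hy w hwC hyw
      obtain ⟨i, rfl⟩ := hf.exists_eq hy
      have hi : i ≠ 6 := by
        rintro rfl
        exact hf.degree_ne_one 6 0 h6 hwC hyw hl
      refine ⟨_, hf.isolates_erase i _ (ht i hi), ?_⟩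
      rw [card_image_singleton_fin, hw]
      norm_num
  · rw [vwt_of_degree_ne_one hl] at hw
    refine Or.inl ⟨_, hiso, ?_⟩
    rw [hw]
    linarith

/-- P₃ and K₃ are treated together, since only a vertex adjacent to the other two matters. -/
theorem goodSet_or_of_isSGraph {C : Finset V} (h : IsSGraph (G.induce (C : Set V))) :
    GoodSet G C ∨ Trio G C ∨ Hex G C ∨ LeafyBad G C := by
  rcases h with ⟨⟨e⟩⟩ | ⟨⟨e⟩⟩ | ⟨⟨e⟩⟩ | ⟨⟨e⟩⟩ | ⟨⟨e⟩⟩ | ⟨⟨e⟩⟩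
  · obtain ⟨f, hf⟩ := exists_labelling e adjP3 pathGraph_three_adj
    refine Or.inr (Or.inl ⟨f 0, f 1, f 2, (hf.adj _ _).2 (by decide), (hf.adj _ _).2 (by decide),
      hf.inj.ne (by decide), ?_⟩)
    rw [hf.image]
    ext v
    simp [Fin.exists_fin_succ, eq_comm]
  · obtain ⟨f, hf⟩ := exists_labelling e adjK3 top_three_adj
    refine Or.inr (Or.inl ⟨f 0, f 1, f 2, (hf.adj _ _).2 (by decide), (hf.adj _ _).2 (by decide),
      hf.inj.ne (by decide), ?_⟩)
    rw [hf.image]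
    ext v
    simp [Fin.exists_fin_succ, eq_comm]
  · obtain ⟨f, hf⟩ := exists_labelling e adjStar starGraph_four_adj
    have := hf.star
    tauto
  · obtain ⟨f, hf⟩ := exists_labelling e adjHex cycleGraph_six_adj
    exact Or.inr (Or.inr (Or.inl ⟨f, hf⟩))
  · obtain ⟨f, hf⟩ := exists_labelling e adjC6' C6'_adj
    -- For example, deleting 0 leaves the path 1, …, 5, with centre 3, and an isolated vertex. The
    -- last entry is a dummy, as the pendant vertex is never deleted.
    have := hf.seven (by decide) (by decide) (by decide) ![3, 5, 5, 0, 1, 1, 0] (by decide)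
    tauto
  · obtain ⟨f, hf⟩ := exists_labelling e adjC6'' C6''_adj
    have := hf.seven (by decide) (by decide) (by decide) ![2, 4, 5, 0, 1, 2, 0] (by decide)
    tauto

theorem Trio.ten_le_wt {C : Finset V} (h : Trio G C) : 10 ≤ wt G C := by
  obtain ⟨a, b, c, hab, hbc, hac, rfl⟩ := h
  have h1 : wt G {a, b, c} = vwt G a + (vwt G b + vwt G c) := by
    rw [wt, Finset.sum_insert, Finset.sum_pair hbc.ne]
    simp [hab.ne, hac]
  have := vwt_of_adj hab.symm hbc hac
  have := three_le_vwt (G := G) a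
  have := three_le_vwt (G := G) c
  linarith

theorem Labelling.wt_hex {C : Finset V} {f : Fin 6 → V} (hf : Labelling G C adjHex f) :
    wt G C = 24 := by
  have h4 : ∀ i, vwt G (f i) = 4 := fun i =>
    hf.vwt_eq_four i (i + 1) (i - 1) (by revert i; decide) (by revert i; decide)
      (by revert i; decide)
  rw [hf.wt_eq, Fin.sum_univ_six]
  simp only [h4]
  norm_num

/-- The deficit 4 comes from the trio (14 against at least 10) and the hexagon (28 against 24). -/
theorem exists_isolates_of_bad {C : Finset V} (h : Trio G C ∨ Hex G C ∨ LeafyBad G C) :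
    ∃ D, Isolates G C D ∧ 14 * (D.card : ℤ) ≤ wt G C + 4 := by
  rcases h with h | ⟨f, hf⟩ | h
  · obtain ⟨D, hD, h1⟩ := h.isolates
    have := h.ten_le_wt
    refine ⟨D, hD, ?_⟩
    rw [h1]
    push_cast
    linarith
  · refine ⟨_, hf.isolates {0, 3} (by decide), ?_⟩
    have := card_image_pair_le f 0 3
    rw [hf.wt_hex]
    linarith
  · obtain ⟨D, hD, h1⟩ := h.isol
    exact ⟨D, hD, by linarith⟩

/-- Deleting one vertex saves a whole element of the isolating set, which turns a deficit of at most
4 into a slack of at least 10. -/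
theorem exists_isolates_erase_of_bad {C : Finset V} (h : Trio G C ∨ Hex G C ∨ LeafyBad G C)
    {y w : V} (hy : y ∈ C) (hw : w ∉ C) (hyw : G.Adj y w) :
    ∃ D, Isolates G (C.erase y) D ∧ 14 * (D.card : ℤ) + 10 ≤ wt G C := by
  rcases h with h | ⟨f, hf⟩ | h
  · have := h.ten_le_wt
    have hc := h.card
    refine ⟨∅, isolates_of_card_le_two ?_ _, by simpa using this⟩
    rw [Finset.card_erase_of_mem hy, hc]
  · obtain ⟨i, rfl⟩ := hf.exists_eq hy
    -- The hexagon without `i` is a path on five vertices with centre `i + 3`.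
    refine ⟨_, hf.isolates_erase i {i + 3} (by clear * -; revert i; decide), ?_⟩
    rw [card_image_singleton_fin, hf.wt_hex]
    norm_num
  · exact h.erase y hy w hw hyw

end Labellings

end GraphIsolation

namespace GraphIsolation

universe u

/-! ### Minimal counterexamples: cut vertices and vertices of degree at least 3 -/

section MinimalCounterexample

open scoped Classical

variable {V : Type u} {G : SimpleGraph V}

theorem Conn.exists_adj {C : Finset V} (h : Conn G C) {a b : V} (ha : a ∈ C) (hb : b ∈ C)
    (hab : a ≠ b) : ∃ c ∈ C, G.Adj a c := by
  by_contra hcon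
  push Not at hcon
  have := h.2 {a} (by simpa using ha) (by simp) (by
    intro s hs c hc hsc
    rw [Finset.mem_singleton] at hs
    subst hs
    exact absurd hsc (hcon c hc))
  rw [← this, Finset.mem_singleton] at hb
  exact hab hb.symm

variable [Fintype V]

/-- `G` is a connected graph violating the bound, all of whose proper connected induced subgraphs
satisfy it. -/
structure MinimalCounterexample (G : SimpleGraph V) : Prop where
  connected : G.Connected
  not_isSGraph : ¬ IsSGraph G
  not_goodSet : ¬ GoodSet G Finset.univ
  induct : ∀ C : Finset V, Conn G C → C ≠ Finset.univ →
    (∃ D, Isolates G C D ∧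
      14 * D.card + (C.filter fun c => (G.neighborFinset c ∩ C).card = 1).card ≤ 4 * C.card) ∨
    IsSGraph (G.induce (C : Set V))

theorem wt_eq_sub (C : Finset V) :
    wt G C = 4 * C.card - (C.filter fun c => G.degree c = 1).card := by
  have : ∀ v, vwt G v = 4 - if G.degree v = 1 then 1 else 0 := by
    intro v
    unfold vwt
    split_ifs <;> norm_num
  simp only [wt, this, Finset.sum_sub_distrib, Finset.sum_const, Finset.sum_boole]
  rw [nsmul_eq_mul]
  ring

namespace MinimalCounterexample

variable (M : MinimalCounterexample G)

include M

/-- Minimality bounds G[C] with the leaves of G[C] counted. Leaves of G in C are among these, so the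
weight taken in G is at least as large. -/
theorem goodSet_or {C : Finset V} (hC : Conn G C) (hne : C ≠ Finset.univ) :
    GoodSet G C ∨ Trio G C ∨ Hex G C ∨ LeafyBad G C := by
  rcases M.induct C hC hne with ⟨D, hD, h⟩ | h
  · left
    -- A leaf of G that forms C alone has degree 0 in G[C], so the comparison of leaves fails here;
    -- the empty set suffices.
    by_cases h1 : C.card ≤ 1
    · exact ⟨∅, isolates_of_card_le_two (by omega) _, by simpa using wt_nonneg C⟩
    · refine ⟨D, hD, ?_⟩
      have hsub : (C.filter fun c => G.degree c = 1) ⊆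
          C.filter fun c => (G.neighborFinset c ∩ C).card = 1 := by
        intro a ha
        rw [Finset.mem_filter] at ha ⊢
        refine ⟨ha.1, le_antisymm ?_ ?_⟩
        · rw [← ha.2, ← SimpleGraph.card_neighborFinset_eq_degree]
          exact Finset.card_le_card Finset.inter_subset_left
        · obtain ⟨b, hb, hba⟩ := Finset.exists_mem_ne (by omega : 1 < C.card) a
          obtain ⟨c, hc, hac⟩ := hC.exists_adj ha.1 hb hba.symm
          exact Finset.card_pos.2 ⟨c, by simp [hc, hac]⟩
      have := Finset.card_le_card hsub
      rw [wt_eq_sub]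
      omega
  · exact goodSet_or_of_isSGraph h

theorem goodSet_or_of_isComp {X C : Finset V} (hX : X.Nonempty) (hC : IsComp G X C) :
    GoodSet G C ∨ Trio G C ∨ Hex G C ∨ LeafyBad G C := by
  refine M.goodSet_or hC.conn ?_
  rintro rfl
  obtain ⟨x, hx⟩ := hX
  exact hC.notMem x (Finset.mem_univ x) hx

/-- Every other component of G - x is good or, being attached to x, loses a dominated vertex and has
slack 10. None of them costs anything, so the slack of C decides. -/
theorem false_of_cut {x : V} {C D : Finset V} {τ : ℤ} (hC : IsComp G {x} C)
    (hD : Isolates G (C.filter fun c => ¬ Dominates G {x} c) D)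
    (hcard : 14 * (D.card : ℤ) + τ ≤ wt G C) (hτ : 14 ≤ vwt G x + τ) : False := by
  have := wt_add_sum_lt M.not_goodSet {x} {x} (fun y hy => dominates_self hy)
    (fun C' => if C' = C then τ else 0) (by
      intro C' hC'
      by_cases hCC : C' = C
      · subst hCC
        exact ⟨D, hD, by simpa using hcard⟩
      · simp only [hCC, if_false]
        rcases M.goodSet_or_of_isComp (Finset.singleton_nonempty x) hC' with ⟨D', h1, h2⟩ | hbad
        · exact ⟨D', h1.mono (Finset.filter_subset _ _) le_rfl, by simpa using h2⟩
        · obtain ⟨c, hc, y, hy, hcy⟩ := hC'.exists_adj M.connected (Finset.singleton_nonempty x)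
          rw [Finset.mem_singleton] at hy
          subst hy
          obtain ⟨D', h1, h2⟩ := exists_isolates_erase_of_bad hbad hc
            (fun h => hC'.notMem y h (Finset.mem_singleton_self y)) hcy
          refine ⟨D', h1.mono ?_ le_rfl, by linarith⟩
          intro z hz
          rw [Finset.mem_filter] at hz
          refine Finset.mem_erase.2 ⟨?_, hz.1⟩
          rintro rfl
          exact hz.2 (dominates_of_adj (Finset.mem_singleton_self y) hcy.symm))
  rw [Finset.sum_ite_eq' (comps G {x}) C, if_pos (mem_comps.2 hC), wt, Finset.sum_singleton,
    Finset.card_singleton] at this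
  push_cast at this
  linarith

/-- A bad component would have slack 10 once x is chosen, and x itself weighs 4. -/
theorem goodSet_of_cut {x : V} {C : Finset V} (hC : IsComp G {x} C) (hx : G.degree x ≠ 1) :
    GoodSet G C := by
  rcases M.goodSet_or_of_isComp (Finset.singleton_nonempty x) hC with h | hbad
  · exact h
  · obtain ⟨c, hc, y, hy, hcy⟩ := hC.exists_adj M.connected (Finset.singleton_nonempty x)
    rw [Finset.mem_singleton] at hy
    subst hy
    obtain ⟨D', h1, h2⟩ := exists_isolates_erase_of_bad hbad hc
      (fun h => hC.notMem y h (Finset.mem_singleton_self y)) hcy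
    refine (M.false_of_cut hC (h1.mono ?_ le_rfl) h2 ?_).elim
    · intro z hz
      rw [Finset.mem_filter] at hz
      refine Finset.mem_erase.2 ⟨?_, hz.1⟩
      rintro rfl
      exact hz.2 (dominates_of_adj (Finset.mem_singleton_self y) hcy.symm)
    · rw [vwt_of_degree_ne_one hx]
      norm_num

end MinimalCounterexample

/-- The closed neighbourhood of a vertex. -/
noncomputable def nbhd (G : SimpleGraph V) (v : V) : Finset V := insert v (G.neighborFinset v)

theorem mem_nbhd {v w : V} : w ∈ nbhd G v ↔ w = v ∨ G.Adj v w := by simp [nbhd]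

theorem nbhd_nonempty (v : V) : (nbhd G v).Nonempty := ⟨v, mem_nbhd.2 (Or.inl rfl)⟩

/-- The components of `G - N[v]` violating the bound. -/
noncomputable def badComps (G : SimpleGraph V) (v : V) : Finset (Finset V) :=
  (comps G (nbhd G v)).filter fun C => ¬ GoodSet G C

theorem mem_badComps {v : V} {C : Finset V} :
    C ∈ badComps G v ↔ IsComp G (nbhd G v) C ∧ ¬ GoodSet G C := by
  simp [badComps, mem_comps]

/-- Some vertex of `A` is adjacent to some vertex of `C`. -/
def Linked (G : SimpleGraph V) (A C : Finset V) : Prop := ∃ x ∈ A, ∃ c ∈ C, G.Adj x c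

theorem IsComp.not_adj {v : V} {C : Finset V} (hC : IsComp G (nbhd G v) C) {c : V} (hc : c ∈ C) :
    ¬ G.Adj v c := fun h => hC.notMem c hc (mem_nbhd.2 (Or.inr h))

theorem IsComp.ne {v : V} {C : Finset V} (hC : IsComp G (nbhd G v) C) {c : V} (hc : c ∈ C) :
    c ≠ v := fun h => hC.notMem c hc (mem_nbhd.2 (Or.inl h))

theorem IsComp.adj_of_adj {v : V} {C : Finset V} (hC : IsComp G (nbhd G v) C) {c w : V}
    (hc : c ∈ C) (hcw : G.Adj c w) : w ∈ C ∨ G.Adj v w := by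
  rcases hC.closed c hc w hcw with h | h
  · exact Or.inl h
  · rcases mem_nbhd.1 h with rfl | h
    · exact absurd hcw.symm (hC.not_adj hc)
    · exact Or.inr h

theorem wt_nbhd {v : V} (hv : G.degree v ≠ 1) :
    wt G (nbhd G v) =
      4 + 3 * G.degree v + ((G.neighborFinset v).filter fun x => G.degree x ≠ 1).card := by
  have : ∀ v, vwt G v = 3 + if G.degree v ≠ 1 then 1 else 0 := by
    intro v
    by_cases h : G.degree v = 1 <;> simp [vwt, h]
  rw [nbhd, wt, Finset.sum_insert (by simp), vwt_of_degree_ne_one hv]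
  simp only [this, Finset.sum_add_distrib, Finset.sum_const, Finset.sum_boole,
    SimpleGraph.card_neighborFinset_eq_degree]
  rw [nsmul_eq_mul]
  ring

namespace MinimalCounterexample

variable (M : MinimalCounterexample G)

include M

theorem bad_of_mem_badComps {v : V} {C : Finset V} (hC : C ∈ badComps G v) :
    Trio G C ∨ Hex G C ∨ LeafyBad G C :=
  (M.goodSet_or_of_isComp (nbhd_nonempty v) (mem_badComps.1 hC).1).resolve_left
    (mem_badComps.1 hC).2

theorem wt_nbhd_lt (v : V) {A : Finset V} (hA : A ⊆ G.neighborFinset v) (σ : Finset V → ℤ)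
    (hσ : ∀ C, IsComp G (nbhd G v) C →
      ∃ D, Isolates G (C.filter fun c => ¬ Dominates G (insert v A) c) D ∧
        14 * (D.card : ℤ) + σ C ≤ wt G C) :
    wt G (nbhd G v) + ∑ C ∈ comps G (nbhd G v), σ C < 14 * (A.card + 1) := by
  have := wt_add_sum_lt M.not_goodSet (nbhd G v) (insert v A) (by
    intro x hx
    rcases mem_nbhd.1 hx with rfl | hx
    · exact dominates_self (by simp)
    · exact dominates_of_adj (Finset.mem_insert_self v A) hx) σ hσ
  rw [Finset.card_insert_of_notMem fun h => by simpa using hA h] at this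
  exact_mod_cast this

/-- With D₀ = {v} ∪ A, a bad component linked to A contains a dominated vertex and gains 10; any
other bad component costs at most 4. -/
theorem wt_nbhd_add_lt (v : V) {A : Finset V} (hA : A ⊆ G.neighborFinset v) :
    wt G (nbhd G v) + (10 * ((badComps G v).filter (Linked G A)).card -
      4 * ((badComps G v).filter fun C => ¬ Linked G A C).card) < 14 * (A.card + 1) := by
  have := M.wt_nbhd_lt v hA
    (fun C => if ¬ GoodSet G C then (if Linked G A C then 10 else -4) else 0) (by
      intro C hC
      by_cases hgood : GoodSet G C
      · obtain ⟨D, h1, h2⟩ := hgood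
        have hgood : GoodSet G C := ⟨D, h1, h2⟩
        exact ⟨D, h1.mono (Finset.filter_subset _ _) le_rfl, by simpa [hgood] using h2⟩
      · have hbad := M.bad_of_mem_badComps (mem_badComps.2 ⟨hC, hgood⟩)
        by_cases hl : Linked G A C
        · obtain ⟨x, hx, c, hc, hxc⟩ := hl
          have hl : Linked G A C := ⟨x, hx, c, hc, hxc⟩
          obtain ⟨D, h1, h2⟩ := exists_isolates_erase_of_bad hbad hc (w := x) (fun h => by
            have := hA hx
            rw [SimpleGraph.mem_neighborFinset] at this
            exact hC.not_adj h this) hxc.symm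
          refine ⟨D, h1.mono ?_ le_rfl, by simpa [hgood, hl] using h2⟩
          intro z hz
          rw [Finset.mem_filter] at hz
          refine Finset.mem_erase.2 ⟨?_, hz.1⟩
          rintro rfl
          exact hz.2 (dominates_of_adj (Finset.mem_insert_of_mem hx) hxc)
        · obtain ⟨D, h1, h2⟩ := exists_isolates_of_bad hbad
          refine ⟨D, h1.mono (Finset.filter_subset _ _) le_rfl, ?_⟩
          simp only [hgood, hl, not_false_eq_true, if_true, if_false]
          linarith)
  rw [← Finset.sum_filter, Finset.sum_ite, Finset.sum_const, Finset.sum_const] at this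
  simp only [nsmul_eq_mul] at this
  unfold badComps
  linarith

/-- If a bad component were attached to N(v) only at x₀, it would be a component of G - x₀ with x₀
not a leaf, hence good. -/
theorem exists_linked_ne {v : V} {C : Finset V} (hC : C ∈ badComps G v) (x₀ : V) :
    ∃ x, G.Adj v x ∧ x ≠ x₀ ∧ ∃ c ∈ C, G.Adj x c := by
  obtain ⟨hcomp, hbad⟩ := mem_badComps.1 hC
  by_contra hcon
  push Not at hcon
  obtain ⟨c, hc, x, hx, hcx⟩ := hcomp.exists_adj M.connected (nbhd_nonempty v)
  have hvx : G.Adj v x :=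
    (hcomp.adj_of_adj hc hcx).resolve_left fun h => hcomp.notMem x h hx
  have hx₀ : x = x₀ := by
    by_contra hne
    exact hcon x hvx hne c hc hcx.symm
  subst hx₀
  refine hbad (M.goodSet_of_cut (x := x) ⟨hcomp.conn, ?_, ?_⟩
    (degree_ne_one_of_adj hvx.symm hcx.symm (hcomp.ne hc).symm))
  · intro c' hc' h
    rw [Finset.mem_singleton] at h
    subst h
    exact hcomp.notMem c' hc' hx
  · intro c' hc' w hw
    rcases hcomp.adj_of_adj hc' hw with h | h
    · exact Or.inl h
    · right
      rw [Finset.mem_singleton]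
      by_contra hne
      exact hcon w h hne c' hc' hw.symm

theorem not_star {v : V} (hv : G.degree v = 3) (h : ∀ x, G.Adj v x → G.degree x = 1) : False := by
  have huniv : nbhd G v = Finset.univ := by
    refine eq_univ_of_closed M.connected (nbhd_nonempty v) ?_
    intro s hs w hsw
    rcases mem_nbhd.1 hs with rfl | hs
    · exact mem_nbhd.2 (Or.inr hsw)
    · by_contra hw
      exact degree_ne_one_of_adj hs.symm hsw (fun e => hw (mem_nbhd.2 (Or.inl e.symm))) (h s hs)
  rw [← SimpleGraph.card_neighborFinset_eq_degree, Finset.card_eq_three] at hv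
  obtain ⟨x, y, z, hxy, hxz, hyz, hN⟩ := hv
  have hadj : ∀ w, G.Adj v w ↔ w = x ∨ w = y ∨ w = z := by
    intro w
    rw [← SimpleGraph.mem_neighborFinset, hN]
    simp
  have hx := (hadj x).2 (Or.inl rfl)
  have hy := (hadj y).2 (Or.inr (Or.inl rfl))
  have hz := (hadj z).2 (Or.inr (Or.inr rfl))
  have hnot : ∀ a b, G.Adj v a → G.Adj v b → ¬ G.Adj a b := fun a b ha hb hab =>
    degree_ne_one_of_adj ha.symm hab hb.ne (h a ha)
  have hlab : Labelling G Finset.univ adjStar ![v, x, y, z] := by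
    refine ⟨?_, ?_, ?_⟩
    · intro i j
      fin_cases i <;> fin_cases j <;>
        simp [hx.ne, hy.ne, hz.ne, hx.ne', hy.ne', hz.ne', hxy, hxz, hyz, hxy.symm, hxz.symm,
          hyz.symm]
    · rw [← huniv, nbhd, hN]
      ext w
      simp [Fin.exists_fin_succ, eq_comm]
    · intro i j
      fin_cases i <;> fin_cases j <;>
        simp [adjStar, hx, hy, hz, hx.symm, hy.symm, hz.symm, hnot]
  exact M.not_isSGraph (Or.inr (Or.inr (Or.inl (hlab.nonempty_iso starGraph_four_adj))))

/-- Write d for the degree of v, m for its number of non-leaf neighbours and b for the number of bad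
components. Three choices of A and a double count give linear inequalities in d, m and b with few
solutions. -/
theorem structure_of_three_le_degree {v : V} (hv : 3 ≤ G.degree v) :
    (G.degree v = 3 ∧ (badComps G v).card = 1 ∧
      2 ≤ ((G.neighborFinset v).filter fun x => G.degree x ≠ 1).card) ∨
    (G.degree v = 4 ∧ (badComps G v).card = 2 ∧
      ((G.neighborFinset v).filter fun x => G.degree x ≠ 1).card = 4) := by
  set N := (G.neighborFinset v).filter fun x => G.degree x ≠ 1 with hN
  have hNsub : N ⊆ G.neighborFinset v := Finset.filter_subset _ _
  have hwt := wt_nbhd (G := G) (v := v) (by omega)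
  rw [← hN] at hwt
  have hmd : N.card ≤ G.degree v := by
    rw [← SimpleGraph.card_neighborFinset_eq_degree]
    exact Finset.card_le_card hNsub
  have hmem : ∀ C ∈ badComps G v, ∀ x, G.Adj v x → (∃ c ∈ C, G.Adj x c) → x ∈ N := by
    rintro C hC x hvx ⟨c, hc, hxc⟩
    rw [hN, Finset.mem_filter, SimpleGraph.mem_neighborFinset]
    exact ⟨hvx, degree_ne_one_of_adj hvx.symm hxc ((mem_badComps.1 hC).1.ne hc).symm⟩
  have hsplit : ∀ A : Finset V, ((badComps G v).filter (Linked G A)).card +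
      ((badComps G v).filter fun C => ¬ Linked G A C).card = (badComps G v).card :=
    fun A => Finset.card_filter_add_card_filter_not _
  have i1 := M.wt_nbhd_add_lt v (A := ∅) (by simp)
  have s1 : ((badComps G v).filter (Linked G ∅)).card = 0 := by
    rw [Finset.card_eq_zero, Finset.filter_eq_empty_iff]
    rintro C - ⟨x, hx, -⟩
    simp at hx
  have s2 := hsplit ∅
  rw [s1] at i1 s2
  rw [Finset.card_empty] at i1
  -- Dropping one neighbour from N still leaves every bad component linked, since each is attached
  -- at two places.
  have i2 : 1 ≤ (badComps G v).card →
      10 * ((badComps G v).card : ℤ) < 13 * N.card - 3 * G.degree v - 4 := by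
    intro hp
    obtain ⟨C, hC⟩ := Finset.card_pos.1 hp
    obtain ⟨x, hvx, -, hxc⟩ := M.exists_linked_ne hC v
    have hxN := hmem C hC x hvx hxc
    have i2 := M.wt_nbhd_add_lt v (A := N.erase x) ((Finset.erase_subset _ _).trans hNsub)
    have s3 : (badComps G v).filter (Linked G (N.erase x)) = badComps G v := by
      rw [Finset.filter_eq_self]
      intro C' hC'
      obtain ⟨x', hvx', hne, hc'⟩ := M.exists_linked_ne hC' x
      exact ⟨x', Finset.mem_erase.2 ⟨hne, hmem C' hC' x' hvx' hc'⟩, hc'⟩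
    have s4 := hsplit (N.erase x)
    rw [s3] at i2 s4
    have s5 := Finset.card_erase_add_one hxN
    omega
  -- If x reached two bad components, A = {x} would give 4b > 3d + m + 4, which contradicts 10b <
  -- 13m - 3d - 4 because m ≤ d.
  have i3 : ∀ x ∈ N, ((badComps G v).filter (Linked G {x})).card ≤ 1 := by
    intro x hx
    by_contra hq
    have i3 := M.wt_nbhd_add_lt v (A := {x}) (by simpa using hNsub hx)
    have s3 := hsplit {x}
    rw [Finset.card_singleton] at i3
    have := i2 (by omega)
    omega
  -- Double count the links: each bad component has at least two, each neighbour at most one.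
  have i4 : 2 * (badComps G v).card ≤ N.card := by
    have h1 := Finset.sum_card_bipartiteAbove_eq_sum_card_bipartiteBelow
      (s := N) (t := badComps G v) (fun x C => Linked G {x} C)
    have h2 : ∑ x ∈ N, (Finset.bipartiteAbove (fun x C => Linked G {x} C)
        (badComps G v) x).card ≤ N.card * 1 :=
      Finset.sum_le_card_nsmul _ _ _ i3
    have h3 : (badComps G v).card * 2 ≤ ∑ C ∈ badComps G v,
        (Finset.bipartiteBelow (fun x C => Linked G {x} C) N C).card := by
      refine Finset.card_nsmul_le_sum (badComps G v) (fun C =>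
        (Finset.bipartiteBelow (fun x C => Linked G {x} C) N C).card) 2 fun C hC => ?_
      obtain ⟨x, hvx, -, hxc⟩ := M.exists_linked_ne hC v
      obtain ⟨y, hvy, hne, hyc⟩ := M.exists_linked_ne hC x
      have : ({x, y} : Finset V) ⊆ Finset.bipartiteBelow (fun x C => Linked G {x} C) N C := by
        intro z hz
        rw [Finset.mem_insert, Finset.mem_singleton] at hz
        rw [Finset.mem_bipartiteBelow]
        rcases hz with rfl | rfl
        · exact ⟨hmem C hC z hvx hxc, z, by simp, hxc⟩
        · exact ⟨hmem C hC z hvy hyc, z, by simp, hyc⟩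
      have := Finset.card_le_card this
      rwa [Finset.card_pair hne.symm] at this
    omega
  have hnotstar : ¬ (G.degree v = 3 ∧ N.card = 0) := by
    rintro ⟨h3, h0⟩
    refine M.not_star h3 fun x hx => ?_
    rw [Finset.card_eq_zero, hN, Finset.filter_eq_empty_iff] at h0
    simpa using h0 ((SimpleGraph.mem_neighborFinset _ _ _).2 hx)
  -- From 3d + m - 4b < 10 and 2b ≤ m ≤ d one gets d ≤ 4. Besides the excluded (3, 0, 0), the
  -- triples (d, m, b) left are (3, 2, 1), (3, 3, 1) and (4, 4, 2).
  omega

end MinimalCounterexample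

end MinimalCounterexample

end GraphIsolation

namespace GraphIsolation

universe u

/-! ### Excluding leaves: tools and small configurations -/

section Leaves

open scoped Classical

variable {V : Type u} {G : SimpleGraph V}

theorem conn_singleton (u : V) : Conn G {u} := by
  refine ⟨⟨u, by simp⟩, fun S hS hne _ => ?_⟩
  exact (Finset.subset_singleton_iff.1 hS).resolve_left hne.ne_empty

theorem conn_triple {a b c : V} (hab : G.Adj a b) (hbc : G.Adj b c) : Conn G {a, b, c} := by
  refine ⟨⟨a, by simp⟩, fun S hS hne hcl => ?_⟩
  have hb : b ∈ S := by
    obtain ⟨s, hs⟩ := hne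
    have := hS hs
    simp only [Finset.mem_insert, Finset.mem_singleton] at this
    rcases this with rfl | rfl | rfl
    · exact hcl s hs b (by simp) hab
    · exact hs
    · exact hcl s hs b (by simp) hbc.symm
  refine Finset.Subset.antisymm hS fun x hx => ?_
  simp only [Finset.mem_insert, Finset.mem_singleton] at hx
  rcases hx with rfl | rfl | rfl
  · exact hcl b hb x (by simp) hab.symm
  · exact hb
  · exact hcl b hb x (by simp) hbc

variable [Fintype V]

theorem eq_of_degree_eq_one {u t w : V} (hu : G.degree u = 1) (ht : G.Adj u t) (hw : G.Adj u w) :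
    w = t := by
  by_contra hne
  exact degree_ne_one_of_adj hw ht hne hu

theorem exists_adj_iff_of_degree_eq_two {x a : V} (hx : G.degree x = 2) (ha : G.Adj x a) :
    ∃ b, b ≠ a ∧ ∀ w, G.Adj x w ↔ w = a ∨ w = b := by
  rw [← SimpleGraph.card_neighborFinset_eq_degree, Finset.card_eq_two] at hx
  obtain ⟨p, q, hpq, hN⟩ := hx
  have hadj : ∀ w, G.Adj x w ↔ w = p ∨ w = q := by
    intro w
    rw [← SimpleGraph.mem_neighborFinset, hN]
    simp
  rcases (hadj a).1 ha with rfl | rfl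
  · exact ⟨q, hpq.symm, hadj⟩
  · exact ⟨p, hpq, fun w => (hadj w).trans or_comm⟩

theorem adj_iff_of_degree_eq_two {x a b : V} (hx : G.degree x = 2) (ha : G.Adj x a)
    (hb : G.Adj x b) (hab : a ≠ b) (w : V) : G.Adj x w ↔ w = a ∨ w = b := by
  obtain ⟨c, -, hc⟩ := exists_adj_iff_of_degree_eq_two hx ha
  rcases (hc b).1 hb with rfl | rfl
  · exact absurd rfl hab
  · exact hc w

theorem isolates_univ {D : Finset V}
    (h : ∀ a b c, ¬ Dominates G D a → ¬ Dominates G D b → ¬ Dominates G D c →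
      G.Adj b a → G.Adj b c → a = c) : Isolates G Finset.univ D := by
  intro a _ b _ c _ hac hab hbc
  by_contra hcon
  push Not at hcon
  exact hac (h a b c hcon.1 hcon.2.1 hcon.2.2 hab.symm hbc)

namespace MinimalCounterexample

variable (M : MinimalCounterexample G)

include M

theorem card_pos_degree (v : V) {w : V} (hw : w ≠ v) : G.degree v ≠ 0 := by
  intro h0
  have := eq_univ_of_closed M.connected (S := {v}) (by simp) (by
    intro s hs w hsw
    rw [Finset.mem_singleton] at hs
    subst hs
    rw [← SimpleGraph.card_neighborFinset_eq_degree, Finset.card_eq_zero] at h0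
    have : w ∈ G.neighborFinset s := by simpa using hsw
    simp [h0] at this)
  have := this.symm ▸ Finset.mem_univ w
  exact hw (Finset.mem_singleton.1 this)

/-- D₀ = {v}, with a better estimate τ for one chosen component and cost 4 for each other bad one.
-/
theorem wt_nbhd_add_lt_of_isComp {v : V} {C D : Finset V} {τ : ℤ} (hC : IsComp G (nbhd G v) C)
    (hD : Isolates G C D) (hτ : 14 * (D.card : ℤ) + τ ≤ wt G C) :
    wt G (nbhd G v) + τ < 14 + 4 * ((badComps G v).erase C).card := by
  have := M.wt_nbhd_lt v (A := ∅) (by simp)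
    (fun C' => if C' = C then τ else if ¬ GoodSet G C' then -4 else 0) (by
      intro C' hC'
      by_cases hCC : C' = C
      · subst hCC
        exact ⟨D, hD.mono (Finset.filter_subset _ _) le_rfl, by simpa using hτ⟩
      · simp only [hCC, if_false]
        by_cases hgood : GoodSet G C'
        · obtain ⟨D', h1, h2⟩ := hgood
          have hgood : GoodSet G C' := ⟨D', h1, h2⟩
          exact ⟨D', h1.mono (Finset.filter_subset _ _) le_rfl, by simpa [hgood] using h2⟩
        · obtain ⟨D', h1, h2⟩ := exists_isolates_of_bad
            (M.bad_of_mem_badComps (mem_badComps.2 ⟨hC', hgood⟩))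
          refine ⟨D', h1.mono (Finset.filter_subset _ _) le_rfl, ?_⟩
          simp only [hgood, not_false_eq_true, if_true]
          linarith)
  rw [← Finset.add_sum_erase _ _ (mem_comps.2 hC), if_pos rfl] at this
  have h2 : ∑ C' ∈ (comps G (nbhd G v)).erase C,
      (if C' = C then τ else if ¬ GoodSet G C' then (-4 : ℤ) else 0) =
      -4 * ((badComps G v).erase C).card := by
    rw [Finset.sum_congr rfl (g := fun C' => if ¬ GoodSet G C' then (-4 : ℤ) else 0)
      (fun C' hC' => if_neg (Finset.ne_of_mem_erase hC')), ← Finset.sum_filter,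
      Finset.filter_erase, Finset.sum_const, nsmul_eq_mul, mul_comm]
    rfl
  rw [h2, Finset.card_empty] at this
  push_cast at this
  linarith

/-- Such a u is a component of G - N[v] with slack at least 3. Since N[v] weighs at least 15 when b
= 1 and exactly 20 when b = 2, the sum reaches 14 + 4b. -/
theorem not_isolated {v u : V} (hv : 3 ≤ G.degree v) (hu : u ∉ nbhd G v)
    (h : ∀ w, G.Adj u w → G.Adj v w) : False := by
  have hC : IsComp G (nbhd G v) {u} := by
    refine ⟨conn_singleton u, by simpa using hu, ?_⟩
    intro c hc w hcw
    rw [Finset.mem_singleton] at hc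
    subst hc
    exact Or.inr (mem_nbhd.2 (Or.inr (h w hcw)))
  have h1 := M.wt_nbhd_add_lt_of_isComp hC (D := ∅) (τ := 3)
    (isolates_of_card_le_two (by simp) _) (by
      have := three_mul_card_le_wt (G := G) {u}
      simpa using this)
  have h2 := Finset.card_erase_le (s := badComps G v) (a := {u})
  rw [wt_nbhd (by omega)] at h1
  have := M.structure_of_three_le_degree hv
  omega

theorem false_of_isolates {D : Finset V} (hD : Isolates G Finset.univ D)
    (h : 14 * (D.card : ℤ) ≤ wt G Finset.univ) : False := M.not_goodSet ⟨D, hD, h⟩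

/-- Choosing y and the vertex opposite to its neighbour on the hexagon leaves only u, x and the two
hexagon neighbours of `f i`, with at most the edge xh among them. Ten vertices weigh at least 30 ≥
28. -/
theorem false_of_leaf_hex {u t x y : V} (hu : ∀ w, G.Adj u w ↔ w = t)
    (ht : ∀ w, G.Adj t w ↔ w = u ∨ w = x ∨ w = y)
    {H : Finset V} {f : Fin 6 → V} (hf : Labelling G H adjHex f) {h : V} {i : Fin 6}
    (hx : ∀ w, G.Adj x w ↔ w = t ∨ w = h) (hy : ∀ w, G.Adj y w ↔ w = t ∨ w = f i)
    (hall : ∀ w, w = u ∨ w = t ∨ w = x ∨ w = y ∨ w ∈ H)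
    (hcard : 10 ≤ (Finset.univ : Finset V).card) : False := by
  refine M.false_of_isolates (D := {y, f (i + 3)}) ?_ ?_
  · have hy' : Dominates G {y, f (i + 3)} y := dominates_self (by simp)
    have ht' : Dominates G {y, f (i + 3)} t :=
      dominates_of_adj (v := y) (by simp) ((hy t).2 (Or.inl rfl))
    have hf' : ∀ j, j ≠ i + 1 → j ≠ i + 5 → Dominates G {y, f (i + 3)} (f j) := by
      intro j h1 h2
      by_cases h0 : j = i
      · subst h0
        exact dominates_of_adj (v := y) (by simp) ((hy _).2 (Or.inr rfl))
      by_cases h3 : j = i + 3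
      · subst h3
        exact dominates_self (by simp)
      · exact dominates_of_adj (v := f (i + 3)) (by simp)
          ((hf.adj _ _).2 (by clear * - h0 h1 h2 h3; revert i j; decide))
    have key : ∀ a b, ¬ Dominates G {y, f (i + 3)} a → ¬ Dominates G {y, f (i + 3)} b →
        G.Adj b a → (b = x ∧ a = h) ∨ a = x := by
      intro a b ha hb hba
      rcases hall b with rfl | rfl | rfl | rfl | hbH
      · rw [hu] at hba
        subst hba
        exact absurd ht' ha
      · exact absurd ht' hb
      · rcases (hx a).1 hba with rfl | rfl
        · exact absurd ht' ha
        · exact Or.inl ⟨rfl, rfl⟩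
      · exact absurd hy' hb
      · rcases hall a with rfl | rfl | rfl | rfl | haH
        · rw [G.adj_comm, hu] at hba
          subst hba
          exact absurd ht' hb
        · exact absurd ht' ha
        · exact Or.inr rfl
        · exact absurd hy' ha
        · obtain ⟨j, rfl⟩ := hf.exists_eq haH
          obtain ⟨k, rfl⟩ := hf.exists_eq hbH
          rw [hf.adj] at hba
          exfalso
          have hj : j = i + 1 ∨ j = i + 5 := by
            by_contra hcon
            push Not at hcon
            exact ha (hf' j hcon.1 hcon.2)
          have hk : k = i + 1 ∨ k = i + 5 := by
            by_contra hcon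
            push Not at hcon
            exact hb (hf' k hcon.1 hcon.2)
          clear * - hj hk hba
          revert i j k
          decide
    apply isolates_univ
    intro a b c ha hb hc hba hbc
    have h1 := key a b ha hb hba
    have h2 := key c b hc hb hbc
    rcases h1 with ⟨rfl, rfl⟩ | rfl
    · rcases h2 with ⟨-, rfl⟩ | rfl
      · rfl
      · exact absurd rfl hbc.ne
    · rcases h2 with ⟨rfl, rfl⟩ | rfl
      · exact absurd rfl hba.ne
      · rfl
  · have h1 := three_mul_card_le_wt (G := G) Finset.univ
    have h2 : (({y, f (i + 3)} : Finset V).card : ℤ) ≤ 2 := by exact_mod_cast Finset.card_le_two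
    omega

/-- The common attachment h dominates x and y, which leaves the edge ut and at most two vertices of
H, not joined to it. -/
theorem false_of_leaf_trio_eq {u t x y h : V} (hu : ∀ w, G.Adj u w ↔ w = t)
    (ht : ∀ w, G.Adj t w ↔ w = u ∨ w = x ∨ w = y)
    {H : Finset V} (hH : H.card = 3) (hh : h ∈ H) (htH : t ∉ H) (huH : u ∉ H)
    (hxH : x ∉ H) (hyH : y ∉ H)
    (hx : ∀ w, G.Adj x w ↔ w = t ∨ w = h) (hy : ∀ w, G.Adj y w ↔ w = t ∨ w = h)
    (hall : ∀ w, w = u ∨ w = t ∨ w = x ∨ w = y ∨ w ∈ H)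
    (hcard : 7 ≤ (Finset.univ : Finset V).card) : False := by
  refine M.false_of_isolates (D := {h}) ?_ ?_
  · have hx' : Dominates G {h} x := dominates_of_adj (v := h) (by simp) ((hx h).2 (Or.inr rfl)).symm
    have hy' : Dominates G {h} y := dominates_of_adj (v := h) (by simp) ((hy h).2 (Or.inr rfl)).symm
    have key : ∀ a b, b ∈ H → ¬ Dominates G {h} a → G.Adj b a → a ∈ H := by
      intro a b hb ha hba
      rcases hall a with rfl | rfl | rfl | rfl | haH
      · rw [G.adj_comm, hu] at hba
        exact absurd (hba ▸ hb) htH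
      · rw [G.adj_comm, ht] at hba
        rcases hba with rfl | rfl | rfl
        · exact absurd hb huH
        · exact absurd hb hxH
        · exact absurd hb hyH
      · exact absurd hx' ha
      · exact absurd hy' ha
      · exact haH
    apply isolates_univ
    intro a b c ha hb hc hba hbc
    rcases hall b with rfl | rfl | rfl | rfl | hbH
    · rw [hu] at hba hbc
      rw [hba, hbc]
    · have h0 : ∀ {a}, ¬ Dominates G {h} a → G.Adj b a → a = u := by
        intro a ha hba
        rcases (ht a).1 hba with rfl | rfl | rfl
        · rfl
        · exact absurd hx' ha
        · exact absurd hy' ha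
      rw [h0 ha hba, h0 hc hbc]
    · exact absurd hx' hb
    · exact absurd hy' hb
    · by_contra hac
      have haH := key a b hbH ha hba
      have hcH := key c b hbH hc hbc
      have h0 : ∀ {a}, ¬ Dominates G {h} a → a ≠ h := by
        rintro a ha rfl
        exact ha (dominates_self (by simp))
      have hsub : ({a, b, c} : Finset V) ⊆ H.erase h := by
        intro z hz
        simp only [Finset.mem_insert, Finset.mem_singleton] at hz
        rw [Finset.mem_erase]
        rcases hz with rfl | rfl | rfl
        · exact ⟨h0 ha, haH⟩
        · exact ⟨h0 hb, hbH⟩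
        · exact ⟨h0 hc, hcH⟩
      have h3 : ({a, b, c} : Finset V).card = 3 := by
        rw [Finset.card_eq_three]
        exact ⟨a, b, c, hba.ne', hac, hbc.ne, rfl⟩
      have h4 := Finset.card_le_card hsub
      have h5 := Finset.card_erase_lt_of_mem hh
      omega
  · have h1 := three_mul_card_le_wt (G := G) Finset.univ
    rw [Finset.card_singleton]
    omega

/-- The vertex y dominates t and k; among u, x, h and l the only edge left is xh. -/
theorem false_of_leaf_trio_center {u t x y h k l : V} (hu : ∀ w, G.Adj u w ↔ w = t)
    (ht : ∀ w, G.Adj t w ↔ w = u ∨ w = x ∨ w = y)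
    (hx : ∀ w, G.Adj x w ↔ w = t ∨ w = h) (hy : ∀ w, G.Adj y w ↔ w = t ∨ w = k)
    (hall : ∀ w, w = u ∨ w = t ∨ w = x ∨ w = y ∨ w = h ∨ w = k ∨ w = l)
    (hhl : ¬ G.Adj h l) (hcard : 7 ≤ (Finset.univ : Finset V).card) : False := by
  refine M.false_of_isolates (D := {y}) ?_ ?_
  · have hy' : Dominates G {y} y := dominates_self (by simp)
    have hk' : Dominates G {y} k := dominates_of_adj (v := y) (by simp) ((hy k).2 (Or.inr rfl))
    have ht' : Dominates G {y} t := dominates_of_adj (v := y) (by simp) ((hy t).2 (Or.inl rfl))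
    have key : ∀ a b, ¬ Dominates G {y} a → ¬ Dominates G {y} b →
        G.Adj b a → (b = x ∧ a = h) ∨ a = x := by
      intro a b ha hb hba
      have hb1 : b ≠ t := fun e => hb (e ▸ ht')
      have ha1 : a ≠ t := fun e => ha (e ▸ ht')
      have hb2 : b ≠ y := fun e => hb (e ▸ hy')
      have ha2 : a ≠ y := fun e => ha (e ▸ hy')
      have hb3 : b ≠ k := fun e => hb (e ▸ hk')
      have ha3 : a ≠ k := fun e => ha (e ▸ hk')
      have hb4 : b ≠ u := fun e => ha1 ((hu a).1 (e ▸ hba))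
      have ha4 : a ≠ u := fun e => hb1 ((hu b).1 (e ▸ hba.symm))
      by_cases hbx : b = x
      · exact Or.inl ⟨hbx, ((hx a).1 (hbx ▸ hba)).resolve_left ha1⟩
      · by_cases hax : a = x
        · exact Or.inr hax
        · exfalso
          have h1 : b = h ∨ b = l := by have := hall b; tauto
          have h2 : a = h ∨ a = l := by have := hall a; tauto
          rcases h1 with rfl | rfl <;> rcases h2 with rfl | rfl
          · exact hba.ne rfl
          · exact hhl hba
          · exact hhl hba.symm
          · exact hba.ne rfl
    apply isolates_univ
    intro a b c ha hb hc hba hbc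
    have h1 := key a b ha hb hba
    have h2 := key c b hc hb hbc
    rcases h1 with ⟨rfl, rfl⟩ | rfl
    · rcases h2 with ⟨-, rfl⟩ | rfl
      · rfl
      · exact absurd rfl hbc.ne
    · rcases h2 with ⟨rfl, rfl⟩ | rfl
      · exact absurd rfl hba.ne
      · rfl
  · have h1 := three_mul_card_le_wt (G := G) Finset.univ
    rw [Finset.card_singleton]
    omega

/-- If l misses h or k, one of y and x isolates. Otherwise t, x, h, l, k, y is a 6-cycle with u
pendant at t, so G is C₆' or, when hk is an edge, C₆''. -/
theorem false_of_leaf_trio_ne {u t x y h k l : V} (hu : ∀ w, G.Adj u w ↔ w = t)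
    (ht : ∀ w, G.Adj t w ↔ w = u ∨ w = x ∨ w = y)
    (hx : ∀ w, G.Adj x w ↔ w = t ∨ w = h) (hy : ∀ w, G.Adj y w ↔ w = t ∨ w = k)
    (hall : ∀ w, w = u ∨ w = t ∨ w = x ∨ w = y ∨ w = h ∨ w = k ∨ w = l)
    (hinj : Function.Injective ![t, x, h, l, k, y, u])
    (hcard : 7 ≤ (Finset.univ : Finset V).card) : False := by
  by_cases hhl : G.Adj h l
  swap
  · exact M.false_of_leaf_trio_center hu ht hx hy hall hhl hcard
  by_cases hkl : G.Adj k l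
  swap
  · refine M.false_of_leaf_trio_center hu (fun w => (ht w).trans (by tauto)) hy hx (l := l) ?_ hkl
      hcard
    intro w
    have := hall w
    tauto
  have himage : (Finset.univ : Finset V) = Finset.univ.image ![t, x, h, l, k, y, u] := by
    ext w
    have := hall w
    simp only [Finset.mem_univ, Finset.mem_image, true_and, Fin.exists_fin_succ, true_iff]
    simp
    tauto
  have hne : ∀ i j, ![t, x, h, l, k, y, u] i = ![t, x, h, l, k, y, u] j ↔ i = j :=
    fun _ _ => hinj.eq_iff
  simp [Fin.forall_fin_succ] at hne
  have sw : ∀ {a b : V} {P : Prop}, (G.Adj a b ↔ P) → (G.Adj b a ↔ P) := fun h =>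
    (G.adj_comm _ _).trans h
  by_cases hhk : G.Adj h k
  · have hlab : Labelling G Finset.univ adjC6'' ![t, x, h, l, k, y, u] := by
      refine ⟨hinj, himage, ?_⟩
      intro i j
      fin_cases i <;> fin_cases j <;>
        simp [adjC6'', adjC6', hu, ht, hx, hy, sw (hu _), sw (ht _), sw (hx _), sw (hy _), hhl, hkl,
          hhk, hhl.symm, hkl.symm, hhk.symm,
          hne]
    exact M.not_isSGraph (by
      have := hlab.nonempty_iso C6''_adj
      unfold IsSGraph
      tauto)
  · have hkh : ¬ G.Adj k h := fun e => hhk e.symm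
    have hlab : Labelling G Finset.univ adjC6' ![t, x, h, l, k, y, u] := by
      refine ⟨hinj, himage, ?_⟩
      intro i j
      fin_cases i <;> fin_cases j <;>
        simp [adjC6', hu, ht, hx, hy, sw (hu _), sw (ht _), sw (hx _), sw (hy _), hhl, hkl,
          hhk, hhl.symm, hkl.symm, hkh,
          hne]
    exact M.not_isSGraph (by
      have := hlab.nonempty_iso C6'_adj
      unfold IsSGraph
      tauto)

end MinimalCounterexample

end Leaves

end GraphIsolation

namespace GraphIsolation

universe u

/-! ### A minimal counterexample has no leaves -/

section Leaves

open scoped Classical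

variable {V : Type u} {G : SimpleGraph V} [Fintype V]

namespace MinimalCounterexample

variable (M : MinimalCounterexample G)

include M

theorem false_of_leaf_adj_degree_two {u t : V} (hu : ∀ w, G.Adj u w ↔ w = t)
    (ht : G.degree t = 2) : False := by
  have hut := (hu t).2 rfl
  have hdu : G.degree u = 1 := by
    rw [← SimpleGraph.card_neighborFinset_eq_degree, Finset.card_eq_one]
    exact ⟨t, by ext w; simp [hu]⟩
  obtain ⟨s, hsu, hts⟩ := exists_adj_iff_of_degree_eq_two ht hut.symm
  have hst := ((hts s).2 (Or.inr rfl)).symm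
  have hsu' : ¬ G.Adj s u := fun h => hst.ne ((hu s).1 h.symm)
  rcases (by omega : G.degree s = 0 ∨ G.degree s = 1 ∨ G.degree s = 2 ∨ 3 ≤ G.degree s)
    with hs | hs | hs | hs
  · exact M.card_pos_degree s hst.ne' hs
  · have huniv : ({u, t, s} : Finset V) = Finset.univ := by
      refine eq_univ_of_closed M.connected (by simp) ?_
      intro a ha w haw
      simp only [Finset.mem_insert, Finset.mem_singleton] at ha ⊢
      rcases ha with rfl | rfl | rfl
      · exact Or.inr (Or.inl ((hu w).1 haw))
      · have := (hts w).1 haw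
        tauto
      · exact Or.inr (Or.inl (eq_of_degree_eq_one hs hst haw))
    have hus' : ¬ G.Adj u s := fun h => hsu' h.symm
    have hlab : Labelling G Finset.univ adjP3 ![u, t, s] := by
      refine ⟨?_, ?_, ?_⟩
      · intro i j
        fin_cases i <;> fin_cases j <;>
          simp [hut.ne, hst.ne, hut.ne', hst.ne', hsu, hsu.symm]
      · rw [← huniv]
        ext w
        simp [Fin.exists_fin_succ, eq_comm]
      · intro i j
        fin_cases i <;> fin_cases j <;>
          simp [adjP3, hut, hut.symm, hst, hst.symm, hsu', hus']
    exact M.not_isSGraph (Or.inl (hlab.nonempty_iso pathGraph_three_adj))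
  · obtain ⟨q, hqt, hsq⟩ := exists_adj_iff_of_degree_eq_two hs hst
    have hsq' := (hsq q).2 (Or.inr rfl)
    have hqu : q ≠ u := fun h => hsu' (h ▸ hsq')
    have hC : IsComp G {q} {u, t, s} := by
      refine ⟨conn_triple hut hst.symm, ?_, ?_⟩
      · intro c hc
        simp only [Finset.mem_insert, Finset.mem_singleton] at hc ⊢
        rcases hc with rfl | rfl | rfl
        · exact hqu.symm
        · exact hqt.symm
        · exact hsq'.ne
      · intro c hc w hcw
        simp only [Finset.mem_insert, Finset.mem_singleton] at hc ⊢
        rcases hc with rfl | rfl | rfl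
        · have := (hu w).1 hcw
          tauto
        · have := (hts w).1 hcw
          tauto
        · have := (hsq w).1 hcw
          tauto
    -- The component u, t, s weighs 3 + 4 + 4, and nothing need be chosen in it once q dominates s.
    -- As q weighs at least 3, the total is 14.
    refine M.false_of_cut (τ := 11) (D := ∅) hC ?_ ?_ ?_
    · refine isolates_of_card_le_two ?_ _
      have : (({u, t, s} : Finset V).filter fun c => ¬ Dominates G {q} c) ⊆ {u, t} := by
        intro c hc
        simp only [Finset.mem_filter, Finset.mem_insert, Finset.mem_singleton] at hc ⊢
        rcases hc with ⟨rfl | rfl | rfl, h⟩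
        · exact Or.inl rfl
        · exact Or.inr rfl
        · exact absurd (dominates_of_adj (by simp) hsq'.symm) h
      exact (Finset.card_le_card this).trans Finset.card_le_two
    · have h1 : wt G {u, t, s} = vwt G u + (vwt G t + vwt G s) := by
        rw [wt, Finset.sum_insert, Finset.sum_pair hst.ne']
        simp [hut.ne, hsu.symm]
      rw [h1, vwt_of_degree_eq_one hdu, vwt_of_degree_ne_one (by omega),
        vwt_of_degree_ne_one (by omega)]
      norm_num
    · have := three_le_vwt (G := G) q
      linarith
  · refine M.not_isolated hs (u := u) ?_ ?_
    · rw [mem_nbhd]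
      rintro (h | h)
      · exact hsu h.symm
      · exact hsu' h
    · intro w hw
      rw [(hu w).1 hw]
      exact hst

theorem false_of_leaf_trio_or_hex {u t x y h k : V} {H : Finset V}
    (hu : ∀ w, G.Adj u w ↔ w = t) (ht : ∀ w, G.Adj t w ↔ w = u ∨ w = x ∨ w = y)
    (hH : Trio G H ∨ Hex G H) (hhH : h ∈ H) (hkH : k ∈ H)
    (hx : ∀ w, G.Adj x w ↔ w = t ∨ w = h) (hy : ∀ w, G.Adj y w ↔ w = t ∨ w = k)
    (hall : ∀ w, w = u ∨ w = t ∨ w = x ∨ w = y ∨ w ∈ H)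
    (hcard : H.card + 4 ≤ (Finset.univ : Finset V).card)
    (htH : t ∉ H) (huH : u ∉ H) (hxH : x ∉ H) (hyH : y ∉ H)
    (hne : t ≠ x ∧ t ≠ y ∧ t ≠ u ∧ x ≠ y ∧ x ≠ u ∧ y ≠ u) : False := by
  rcases hH with hT | ⟨f, hf⟩
  · have hH3 := hT.card
    by_cases hhk : h = k
    · subst hhk
      exact M.false_of_leaf_trio_eq hu ht hH3 hhH htH huH hxH hyH hx hy hall (by omega)
    · obtain ⟨l, hl⟩ : ∃ l, (H.erase h).erase k = {l} := by
        rw [← Finset.card_eq_one, Finset.card_erase_of_mem, Finset.card_erase_of_mem hhH, hH3]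
        exact Finset.mem_erase.2 ⟨Ne.symm hhk, hkH⟩
      have hlm : l ∈ (H.erase h).erase k := by simp [hl]
      simp only [Finset.mem_erase] at hlm
      obtain ⟨hlk, hlh, hlH⟩ := hlm
      have hH' : ∀ w, w ∈ H → w = h ∨ w = k ∨ w = l := by
        intro w hw
        by_contra hcon
        push Not at hcon
        have : w ∈ (H.erase h).erase k := by simp [hcon, hw]
        rw [hl, Finset.mem_singleton] at this
        exact hcon.2.2 this
      have hneH : ∀ {a b}, a ∉ H → b ∈ H → a ≠ b := fun ha hb e => ha (e ▸ hb)
      refine M.false_of_leaf_trio_ne hu ht hx hy (h := h) (k := k) (l := l) ?_ ?_ (by omega)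
      · intro w
        rcases hall w with e | e | e | e | e
        · exact Or.inl e
        · exact Or.inr (Or.inl e)
        · exact Or.inr (Or.inr (Or.inl e))
        · exact Or.inr (Or.inr (Or.inr (Or.inl e)))
        · exact Or.inr (Or.inr (Or.inr (Or.inr (hH' w e))))
      · have : List.Nodup [t, x, h, l, k, y, u] := by
          simp only [List.nodup_cons, List.mem_cons, List.not_mem_nil, not_or, or_false,
            not_false_eq_true, List.nodup_nil, and_true]
          obtain ⟨h1, h2, h3, h4, h5, h6⟩ := hne
          exact ⟨⟨h1, hneH htH hhH, hneH htH hlH, hneH htH hkH, h2, h3⟩,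
            ⟨hneH hxH hhH, hneH hxH hlH, hneH hxH hkH, h4, h5⟩,
            ⟨Ne.symm hlh, hhk, (hneH hyH hhH).symm, (hneH huH hhH).symm⟩,
            ⟨hlk, (hneH hyH hlH).symm, (hneH huH hlH).symm⟩,
            ⟨(hneH hyH hkH).symm, (hneH huH hkH).symm⟩, h6⟩
        exact List.nodup_ofFn.1 (by simpa [List.ofFn_succ] using this)
  · obtain ⟨i, rfl⟩ := hf.exists_eq hkH
    have := hf.card
    exact M.false_of_leaf_hex hu ht hf hx hy hall (by omega)

/-- The neighbour t of a leaf must have degree 3, and its two other neighbours degree 2. They both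
lead into the only bad component H, so G consists of u, t, x, y and H. -/
theorem degree_ne_one (u : V) : G.degree u ≠ 1 := by
  intro hdu
  obtain ⟨t, hut⟩ : ∃ t, G.Adj u t := by
    rw [← SimpleGraph.card_neighborFinset_eq_degree, Finset.card_eq_one] at hdu
    obtain ⟨t, ht⟩ := hdu
    exact ⟨t, by rw [← SimpleGraph.mem_neighborFinset, ht]; simp⟩
  have hu : ∀ w, G.Adj u w ↔ w = t := fun w =>
    ⟨fun h => eq_of_degree_eq_one hdu hut h, fun h => h ▸ hut⟩
  rcases (by omega : G.degree t = 0 ∨ G.degree t = 1 ∨ G.degree t = 2 ∨ 3 ≤ G.degree t)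
    with ht | ht | ht | ht
  · exact M.card_pos_degree t hut.ne ht
  · have huniv : ({u, t} : Finset V) = Finset.univ := by
      refine eq_univ_of_closed M.connected (by simp) ?_
      intro a ha w haw
      simp only [Finset.mem_insert, Finset.mem_singleton] at ha ⊢
      rcases ha with rfl | rfl
      · exact Or.inr ((hu w).1 haw)
      · exact Or.inl (eq_of_degree_eq_one ht hut.symm haw)
    refine M.false_of_isolates (D := ∅) (isolates_of_card_le_two ?_ _) ?_
    · rw [← huniv]
      exact Finset.card_le_two
    · simpa using wt_nonneg Finset.univ
  · exact M.false_of_leaf_adj_degree_two hu ht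
  have huN : u ∈ G.neighborFinset t := by simpa using hut.symm
  have huF : u ∉ (G.neighborFinset t).filter fun x => G.degree x ≠ 1 := by simp [hdu]
  have hlt : ((G.neighborFinset t).filter fun x => G.degree x ≠ 1).card < G.degree t := by
    rw [← SimpleGraph.card_neighborFinset_eq_degree]
    exact Finset.card_lt_card (Finset.filter_ssubset.2 ⟨u, huN, by simp [hdu]⟩)
  -- The leaf u makes m < d, which leaves only (d, m, b) = (3, 2, 1).
  obtain ⟨hd3, hp, hm⟩ : G.degree t = 3 ∧ (badComps G t).card = 1 ∧
      ((G.neighborFinset t).filter fun x => G.degree x ≠ 1).card = 2 := by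
    have := M.structure_of_three_le_degree ht
    omega
  obtain ⟨H, hH⟩ := Finset.card_eq_one.1 hp
  have hHb : H ∈ badComps G t := by simp [hH]
  have hHc := (mem_badComps.1 hHb).1
  obtain ⟨x, y, hxy, hF⟩ := Finset.card_eq_two.1 hm
  have hdeg2 : ∀ x, G.Adj t x → G.degree x ≠ 1 → G.degree x = 2 := by
    intro x htx hx1
    by_contra hx2
    have hx0 := M.card_pos_degree x htx.ne
    refine M.not_isolated (v := x) (u := u) (by omega) ?_ ?_
    · rw [mem_nbhd]
      rintro (h | h)
      · exact hx1 (h ▸ hdu)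
      · exact htx.ne' ((hu x).1 h.symm)
    · intro w hw
      rw [(hu w).1 hw]
      exact htx.symm
  have hxF : x ∈ (G.neighborFinset t).filter fun x => G.degree x ≠ 1 := by simp [hF]
  have hyF : y ∈ (G.neighborFinset t).filter fun x => G.degree x ≠ 1 := by simp [hF]
  have hNt : insert u ((G.neighborFinset t).filter fun x => G.degree x ≠ 1) =
      G.neighborFinset t := by
    refine Finset.eq_of_subset_of_card_le ?_ ?_
    · exact Finset.insert_subset huN (Finset.filter_subset _ _)
    · rw [Finset.card_insert_of_notMem huF, hm, SimpleGraph.card_neighborFinset_eq_degree, hd3]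
  have htadj : ∀ w, G.Adj t w ↔ w = u ∨ w = x ∨ w = y := by
    intro w
    rw [← SimpleGraph.mem_neighborFinset, ← hNt, hF]
    simp
  rw [Finset.mem_filter, SimpleGraph.mem_neighborFinset] at hxF hyF
  have hlink : ∀ z z', (∀ w, G.Adj t w ↔ w = u ∨ w = z ∨ w = z') → G.degree z ≠ 1 →
      ∃ h ∈ H, ∀ w, G.Adj z w ↔ w = t ∨ w = h := by
    intro z z' hz hz1
    obtain ⟨p, htp, hpz, c, hc, hpc⟩ := M.exists_linked_ne hHb z'
    have htc : t ≠ c := (hHc.ne hc).symm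
    rcases (hz p).1 htp with rfl | rfl | rfl
    · exact absurd ((hu c).1 hpc).symm htc
    · exact ⟨c, hc, adj_iff_of_degree_eq_two (hdeg2 p htp hz1) htp.symm hpc htc⟩
    · exact absurd rfl hpz
  obtain ⟨h, hhH, hx⟩ := hlink x y htadj hxF.2
  obtain ⟨k, hkH, hy⟩ := hlink y x (fun w => (htadj w).trans (by rw [or_comm (a := w = x)])) hyF.2
  have htH : t ∉ H := fun hm => hHc.ne hm rfl
  have hnb : ∀ w, G.Adj t w → w ∉ H := fun w hw hm => hHc.not_adj hm hw
  have huH := hnb u hut.symm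
  have hxH := hnb x hxF.1
  have hyH := hnb y hyF.1
  have hall : ∀ w, w = u ∨ w = t ∨ w = x ∨ w = y ∨ w ∈ H := by
    have : insert u (insert t (insert x (insert y H))) = Finset.univ := by
      refine eq_univ_of_closed M.connected (by simp) ?_
      intro a ha w haw
      simp only [Finset.mem_insert] at ha ⊢
      rcases ha with rfl | rfl | rfl | rfl | ha
      · exact Or.inr (Or.inl ((hu w).1 haw))
      · rcases (htadj w).1 haw with e | e | e <;> simp [e]
      · rcases (hx w).1 haw with e | e <;> simp [e, hhH]
      · rcases (hy w).1 haw with e | e <;> simp [e, hkH]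
      · rcases hHc.adj_of_adj ha haw with h1 | h1
        · simp [h1]
        · rcases (htadj w).1 h1 with e | e | e <;> simp [e]
    intro w
    have hw := Finset.mem_univ w
    rw [← this] at hw
    simpa using hw
  have hcard : H.card + 4 ≤ (Finset.univ : Finset V).card := by
    have : (insert u (insert t (insert x (insert y H)))).card = H.card + 4 := by
      rw [Finset.card_insert_of_notMem, Finset.card_insert_of_notMem,
        Finset.card_insert_of_notMem, Finset.card_insert_of_notMem hyH]
      · simp [hxy, hxH]
      · simp [hxF.1.ne, hyF.1.ne, htH]
      · simp only [Finset.mem_insert, not_or]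
        refine ⟨hut.ne, ?_, ?_, huH⟩
        · rintro rfl
          exact hxF.2 hdu
        · rintro rfl
          exact hyF.2 hdu
    rw [← this]
    exact Finset.card_le_card (Finset.subset_univ _)
  refine M.false_of_leaf_trio_or_hex hu htadj ?_ hhH hkH hx hy hall hcard htH huH hxH hyH ?_
  · rcases M.bad_of_mem_badComps hHb with hT | hX | hL
    · exact Or.inl hT
    · exact Or.inr hX
    · obtain ⟨D, hD, hc⟩ := hL.isol
      -- N[t] weighs 15 and there is no other bad component, so a deficit of 1 is affordable.
      have h1 := M.wt_nbhd_add_lt_of_isComp hHc (τ := -1) hD (by linarith)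
      have h2 := Finset.card_erase_add_one hHb
      rw [wt_nbhd (by omega)] at h1
      omega
  · refine ⟨hxF.1.ne, hyF.1.ne, hut.ne', hxy, ?_, ?_⟩
    · rintro rfl
      exact hxF.2 hdu
    · rintro rfl
      exact hyF.2 hdu

end MinimalCounterexample

end Leaves

end GraphIsolation

namespace GraphIsolation

universe u

/-! ### Leafless case: no vertex of degree 3 or more -/

section Cubic

open scoped Classical

variable {V : Type u} {G : SimpleGraph V}

theorem Labelling.rotate {C : Finset V} {f : Fin 6 → V} (hf : Labelling G C adjHex f) (k : Fin 6) :
    Labelling G C adjHex fun j => f (j + k) := by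
  refine ⟨fun a b h => add_right_cancel (hf.inj h), ?_, ?_⟩
  · rw [hf.image]
    ext v
    simp only [Finset.mem_image, Finset.mem_univ, true_and]
    constructor
    · rintro ⟨i, rfl⟩
      exact ⟨i - k, by rw [sub_add_cancel]⟩
    · rintro ⟨i, rfl⟩
      exact ⟨i + k, rfl⟩
  · intro i j
    rw [hf.adj]
    revert i j k
    decide

theorem Hex.not_three_adj {C : Finset V} (hC : Hex G C) {z a b c : V} (hz : z ∈ C) (ha : a ∈ C)
    (hb : b ∈ C) (hc : c ∈ C) (hza : G.Adj z a) (hzb : G.Adj z b) (hzc : G.Adj z c)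
    (hab : a ≠ b) (hac : a ≠ c) (hbc : b ≠ c) : False := by
  obtain ⟨f, hf⟩ := hC
  obtain ⟨i, rfl⟩ := hf.exists_eq hz
  obtain ⟨j, rfl⟩ := hf.exists_eq ha
  obtain ⟨k, rfl⟩ := hf.exists_eq hb
  obtain ⟨l, rfl⟩ := hf.exists_eq hc
  rw [hf.adj] at hza hzb hzc
  have h1 : j ≠ k := fun e => hab (e ▸ rfl)
  have h2 : j ≠ l := fun e => hac (e ▸ rfl)
  have h3 : k ≠ l := fun e => hbc (e ▸ rfl)
  clear * - hza hzb hzc h1 h2 h3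
  revert i j k l
  decide

theorem Hex.not_triangle {C : Finset V} (hC : Hex G C) {a b c : V} (ha : a ∈ C)
    (hb : b ∈ C) (hc : c ∈ C) (hab : G.Adj a b) (hbc : G.Adj b c) (hac : G.Adj a c) : False := by
  obtain ⟨f, hf⟩ := hC
  obtain ⟨j, rfl⟩ := hf.exists_eq ha
  obtain ⟨k, rfl⟩ := hf.exists_eq hb
  obtain ⟨l, rfl⟩ := hf.exists_eq hc
  rw [hf.adj] at hab hbc hac
  clear * - hab hbc hac
  revert j k l
  decide

theorem Hex.exists_adj_ne {C : Finset V} (hC : Hex G C) {z : V} (hz : z ∈ C) (a : V) :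
    ∃ b ∈ C, b ≠ a ∧ G.Adj z b := by
  obtain ⟨f, hf⟩ := hC
  obtain ⟨i, rfl⟩ := hf.exists_eq hz
  by_cases h : f (i + 1) = a
  · refine ⟨f (i + 5), hf.mem _, ?_, (hf.adj _ _).2 (by clear * -; revert i; decide)⟩
    rw [← h]
    exact hf.inj.ne (by clear * -; revert i; decide)
  · exact ⟨f (i + 1), hf.mem _, h, (hf.adj _ _).2 (by clear * -; revert i; decide)⟩

variable [Fintype V]

namespace MinimalCounterexample

variable (M : MinimalCounterexample G)

include M

theorem wt_eq (C : Finset V) : wt G C = 4 * C.card := by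
  rw [wt, Finset.sum_congr rfl fun v _ => vwt_of_degree_ne_one (M.degree_ne_one v),
    Finset.sum_const, nsmul_eq_mul, mul_comm]

/-- Without leaves a trio weighs 12 and costs only 2. N[v] weighs 16 or 20, so 14 or 18 is left,
exactly 14 plus 4 for each remaining bad component. -/
theorem not_trio {v : V} (hv : 3 ≤ G.degree v) {C : Finset V} (hC : IsComp G (nbhd G v) C)
    (hT : Trio G C) : False := by
  obtain ⟨D, hD, hD1⟩ := hT.isolates
  have hC3 := hT.card
  have hbad : C ∈ badComps G v := by
    refine mem_badComps.2 ⟨hC, ?_⟩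
    rintro ⟨D', hD', hc⟩
    rw [M.wt_eq, hC3] at hc
    have : D' = ∅ := by
      rw [← Finset.card_eq_zero]
      omega
    subst this
    obtain ⟨a, b, c, hab, hbc, hac, rfl⟩ := hT
    have := hD' a (by simp) b (by simp) c (by simp) hac hab hbc
    simp [Dominates] at this
  have h1 := M.wt_nbhd_add_lt_of_isComp hC (τ := -2) hD (by
    rw [M.wt_eq, hC3, hD1]
    norm_num)
  have h2 := Finset.card_erase_add_one hbad
  have h3 : ((G.neighborFinset v).filter fun x => G.degree x ≠ 1).card = G.degree v := by
    rw [Finset.filter_true_of_mem fun x _ => M.degree_ne_one x,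
      SimpleGraph.card_neighborFinset_eq_degree]
  rw [wt_nbhd (by omega), h3] at h1
  have := M.structure_of_three_le_degree hv
  omega

theorem hex_of_mem_badComps {v : V} (hv : 3 ≤ G.degree v) {C : Finset V}
    (hC : C ∈ badComps G v) : Hex G C := by
  rcases M.bad_of_mem_badComps hC with h | h | h
  · exact (M.not_trio hv (mem_badComps.1 hC).1 h).elim
  · exact h
  · obtain ⟨u, -, hu⟩ := h.leaf
    exact absurd hu (M.degree_ne_one u)

theorem exists_mem_badComps {v : V} (hv : 3 ≤ G.degree v) : ∃ C, C ∈ badComps G v := by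
  have := M.structure_of_three_le_degree hv
  exact Finset.card_pos.1 (by omega)

/-- Remove a bad hexagon H with an attaching neighbour x of v: seven vertices of weight 28,
dominated by two. If v has degree at least 4, all remaining components are good. -/
theorem degree_le_three (v : V) : G.degree v ≤ 3 := by
  by_contra hv
  push Not at hv
  obtain ⟨H, hH⟩ := M.exists_mem_badComps (v := v) (by omega)
  have hHc := (mem_badComps.1 hH).1
  obtain ⟨f, hf⟩ := M.hex_of_mem_badComps (by omega) hH
  obtain ⟨x, hvx, -, c, hc, hxc⟩ := M.exists_linked_ne hH v
  obtain ⟨i, rfl⟩ := hf.exists_eq hc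
  have hxH : x ∉ H := fun h => hHc.not_adj h hvx
  have hvH : v ∉ H := fun h => hHc.ne h rfl
  have hgood : ∀ K, IsComp G (insert x H) K → GoodSet G K := by
    intro K hK
    -- The component of v contains a vertex with three neighbours inside, so it is neither a trio
    -- nor a hexagon. Any other component has no edge to H, because outside H its vertices are
    -- adjacent only to neighbours of v; it is thus a component of G - x.
    by_cases hvK : v ∈ K
    · have hsub : ∀ w, G.Adj v w → w ≠ x → w ∈ K := by
        intro w hw hwx
        rcases hK.closed v hvK w hw with h | h
        · exact h
        · rcases Finset.mem_insert.1 h with h | h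
          · exact absurd h hwx
          · exact absurd hw (hHc.not_adj h)
      have hcard : 3 ≤ ((G.neighborFinset v).erase x).card := by
        have := Finset.card_erase_add_one (s := G.neighborFinset v) (a := x) (by simpa using hvx)
        rw [SimpleGraph.card_neighborFinset_eq_degree] at this
        omega
      obtain ⟨a, b, c, ha, hb, hc, hab, hac, hbc⟩ := Finset.two_lt_card_iff.1 hcard
      simp only [Finset.mem_erase, SimpleGraph.mem_neighborFinset] at ha hb hc
      rcases M.goodSet_or_of_isComp (Finset.insert_nonempty x H) hK with h | h | h | h
      · exact h
      · have h4 : ({v, a, b, c} : Finset V) ⊆ K := by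
          intro z hz
          simp only [Finset.mem_insert, Finset.mem_singleton] at hz
          rcases hz with rfl | rfl | rfl | rfl
          · exact hvK
          · exact hsub _ ha.2 ha.1
          · exact hsub _ hb.2 hb.1
          · exact hsub _ hc.2 hc.1
        have h5 := Finset.card_le_card h4
        rw [h.card, Finset.card_insert_of_notMem (by simp [ha.2.ne, hb.2.ne, hc.2.ne]),
          Finset.card_eq_three.2 ⟨a, b, c, hab, hac, hbc, rfl⟩] at h5
        omega
      · exact (h.not_three_adj hvK (hsub _ ha.2 ha.1) (hsub _ hb.2 hb.1) (hsub _ hc.2 hc.1)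
          ha.2 hb.2 hc.2 hab hac hbc).elim
      · obtain ⟨u, -, hu⟩ := h.leaf
        exact absurd hu (M.degree_ne_one u)
    · refine M.goodSet_of_cut (x := x) ⟨hK.conn, ?_, ?_⟩ (M.degree_ne_one x)
      · intro k hk h
        exact hK.notMem k hk (Finset.mem_insert.2 (Or.inl (Finset.mem_singleton.1 h)))
      · intro k hk w hkw
        rcases hK.closed k hk w hkw with h | h
        · exact Or.inl h
        · rcases Finset.mem_insert.1 h with h | h
          · exact Or.inr (Finset.mem_singleton.2 h)
          · exfalso
            rcases hHc.adj_of_adj h hkw.symm with h1 | h1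
            · exact hK.notMem k hk (Finset.mem_insert_of_mem h1)
            · rcases hK.closed k hk v h1.symm with h2 | h2
              · exact hvK h2
              · rcases Finset.mem_insert.1 h2 with h2 | h2
                · exact hvx.ne h2
                · exact hvH h2
  have := wt_add_sum_lt M.not_goodSet (insert x H) {f i, f (i + 3)} (by
    intro z hz
    rcases Finset.mem_insert.1 hz with rfl | hz
    · exact dominates_of_adj (v := f i) (by simp) hxc.symm
    · obtain ⟨j, rfl⟩ := hf.exists_eq hz
      by_cases h0 : j = i
      · exact dominates_self (by simp [h0])
      by_cases h3 : j = i + 3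
      · exact dominates_self (by simp [h3])
      by_cases h1 : adjHex i j = true
      · exact dominates_of_adj (v := f i) (by simp) ((hf.adj _ _).2 h1)
      · exact dominates_of_adj (v := f (i + 3)) (by simp) ((hf.adj _ _).2 (by
          clear * - h0 h1 h3
          revert i j
          decide))) (fun _ => 0) (by
    intro K hK
    obtain ⟨D, h1, h2⟩ := hgood K hK
    exact ⟨D, h1.mono (Finset.filter_subset _ _) le_rfl, by simpa using h2⟩)
  have h2 : (({f i, f (i + 3)} : Finset V).card : ℤ) ≤ 2 := by exact_mod_cast Finset.card_le_two
  rw [M.wt_eq, Finset.card_insert_of_notMem hxH, hf.card] at this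
  simp at this
  omega

/-- Now `f i` is cubic too, so G - N[`f i`] has a bad hexagon of its own. It must consist of the far
half of H together with v and its other neighbours p and q, in cyclic order `f (i + 3)`, `f (i +
2)`, p, v, q, `f (i + 4)`. -/
theorem hexagon_neighborhood {v x : V} {H : Finset V} (hv : G.degree v = 3)
    (hH : H ∈ badComps G v) {f : Fin 6 → V} (hf : Labelling G H adjHex f) {i : Fin 6}
    (hvx : G.Adj v x) (hx : G.Adj x (f i)) :
    ∃ p q, p ≠ q ∧ p ≠ x ∧ q ≠ x ∧ (∀ w, G.Adj v w ↔ w = x ∨ w = p ∨ w = q) ∧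
      G.Adj (f (i + 2)) p ∧ G.Adj (f (i + 4)) q ∧ ¬ G.Adj p q ∧
      ¬ G.Adj (f (i + 3)) p ∧ ¬ G.Adj (f (i + 3)) q ∧
      IsComp G (nbhd G (f i)) {f (i + 2), f (i + 3), f (i + 4), v, p, q} := by
  have hHc := (mem_badComps.1 hH).1
  have hadj : ∀ j k, adjHex (i + j) (i + k) = true → G.Adj (f (i + j)) (f (i + k)) :=
    fun j k h => (hf.adj _ _).2 h
  have hnadj : ∀ j k, adjHex (i + j) (i + k) = false → ¬ G.Adj (f (i + j)) (f (i + k)) :=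
    fun j k h h' => by simp [(hf.adj _ _).1 h'] at h
  have hvH : ∀ j, ¬ G.Adj v (f j) := fun j => hHc.not_adj (hf.mem j)
  have hvne : ∀ j, f j ≠ v := fun j => hHc.ne (hf.mem j)
  have hfne : ∀ w, G.Adj v w → ∀ j, f j ≠ w := fun w hw j e => hvH j (e ▸ hw)
  have hinj : ∀ j k, j ≠ k → f (i + j) ≠ f (i + k) := fun j k hjk e =>
    hjk (add_left_cancel (hf.inj e))
  have hi0 : f (i + 0) = f i := by rw [add_zero]
  have hN3 : ({x, f (i + 1), f (i + 5)} : Finset V).card = 3 :=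
    Finset.card_eq_three.2 ⟨_, _, _, (hfne x hvx _).symm, (hfne x hvx _).symm,
      hinj 1 5 (by decide), rfl⟩
  have hNsub : ({x, f (i + 1), f (i + 5)} : Finset V) ⊆ G.neighborFinset (f i) := by
    intro z hz
    simp only [Finset.mem_insert, Finset.mem_singleton] at hz
    rw [SimpleGraph.mem_neighborFinset]
    rcases hz with rfl | rfl | rfl
    · exact hx.symm
    · rw [← hi0]
      exact hadj 0 1 (by clear * -; revert i; decide)
    · rw [← hi0]
      exact hadj 0 5 (by clear * -; revert i; decide)
  have hNeq := Finset.eq_of_subset_of_card_le hNsub (by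
    rw [hN3, SimpleGraph.card_neighborFinset_eq_degree]
    exact M.degree_le_three _)
  have hyd : 3 ≤ G.degree (f i) := by
    rw [← SimpleGraph.card_neighborFinset_eq_degree, ← hNeq, hN3]
  have hy : ∀ w, G.Adj (f i) w ↔ w = x ∨ w = f (i + 1) ∨ w = f (i + 5) := by
    intro w
    rw [← SimpleGraph.mem_neighborFinset, ← hNeq]
    simp
  obtain ⟨p, q, hpq, hE⟩ : ∃ p q, p ≠ q ∧ (G.neighborFinset v).erase x = {p, q} := by
    rw [← Finset.card_eq_two, Finset.card_erase_of_mem (by simpa using hvx),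
      SimpleGraph.card_neighborFinset_eq_degree, hv]
  have hpE : p ∈ (G.neighborFinset v).erase x := by simp [hE]
  have hqE : q ∈ (G.neighborFinset v).erase x := by simp [hE]
  rw [Finset.mem_erase, SimpleGraph.mem_neighborFinset] at hpE hqE
  obtain ⟨hpx, hvp⟩ := hpE
  obtain ⟨hqx, hvq⟩ := hqE
  have hNv : ∀ w, G.Adj v w ↔ w = x ∨ w = p ∨ w = q := by
    intro w
    rw [← SimpleGraph.mem_neighborFinset, ← Finset.insert_erase (s := G.neighborFinset v)
      (a := x) (by simpa using hvx), hE]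
    simp
  have hnot : ∀ w, w ∉ nbhd G (f i) ↔ w ≠ f i ∧ w ≠ x ∧ w ≠ f (i + 1) ∧ w ≠ f (i + 5) := by
    intro w
    rw [mem_nbhd, hy]
    simp only [not_or]
  have hfnot : ∀ j, j ≠ 0 → j ≠ 1 → j ≠ 5 → f (i + j) ∉ nbhd G (f i) := by
    intro j h0 h1 h5
    rw [hnot, ← hi0]
    exact ⟨hinj _ _ h0, hfne x hvx _, hinj _ _ h1, hinj _ _ h5⟩
  have hvnot : v ∉ nbhd G (f i) := (hnot v).2 ⟨(hvne _).symm, hvx.ne, (hvne _).symm, (hvne _).symm⟩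
  have hpnot : p ∉ nbhd G (f i) :=
    (hnot p).2 ⟨(hfne p hvp _).symm, hpx, (hfne p hvp _).symm, (hfne p hvp _).symm⟩
  have hqnot : q ∉ nbhd G (f i) :=
    (hnot q).2 ⟨(hfne q hvq _).symm, hqx, (hfne q hvq _).symm, (hfne q hvq _).symm⟩
  obtain ⟨Z, hZ, hcZ⟩ := exists_isComp (G := G) _ (hfnot 3 (by decide) (by decide) (by decide))
  have hbZ : f (i + 2) ∈ Z := (hZ.closed _ hcZ _ (hadj 3 2 (by clear * -; revert i; decide))
    ).resolve_right (hfnot 2 (by decide) (by decide) (by decide))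
  have hdZ : f (i + 4) ∈ Z := (hZ.closed _ hcZ _ (hadj 3 4 (by clear * -; revert i; decide))
    ).resolve_right (hfnot 4 (by decide) (by decide) (by decide))
  have hvZ_of : ∀ w, w ∈ Z → G.Adj v w → v ∈ Z := fun w hw hvw =>
    (hZ.closed w hw v hvw.symm).resolve_right hvnot
  -- Otherwise the far half of H would be a whole component, a trio.
  have hvZ : v ∈ Z := by
    by_contra hvZ
    have hcl : ∀ j, f (i + j) ∈ Z → ∀ w, G.Adj (f (i + j)) w → w = x ∨ ∃ k, w = f (i + k) := by
      intro j hj w hw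
      rcases hHc.adj_of_adj (hf.mem _) hw with h | h
      · obtain ⟨k, rfl⟩ := hf.exists_eq h
        exact Or.inr ⟨k - i, by rw [add_sub_cancel]⟩
      · have hw' : w ∉ Z := fun hwZ => hvZ (hvZ_of w hwZ h)
        have := (hZ.closed _ hj w hw).resolve_left hw'
        rcases (hNv w).1 h with rfl | rfl | rfl
        · exact Or.inl rfl
        · exact absurd this hpnot
        · exact absurd this hqnot
    refine M.not_trio hyd (C := {f (i + 2), f (i + 3), f (i + 4)}) ⟨conn_triple
      (hadj 2 3 (by clear * -; revert i; decide)) (hadj 3 4 (by clear * -; revert i; decide)),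
      ?_, ?_⟩ ⟨_, _, _, hadj 2 3 (by clear * -; revert i; decide),
      hadj 3 4 (by clear * -; revert i; decide), hinj 2 4 (by decide), rfl⟩
    · intro c hc
      simp only [Finset.mem_insert, Finset.mem_singleton] at hc
      rcases hc with rfl | rfl | rfl
      · exact hfnot 2 (by decide) (by decide) (by decide)
      · exact hfnot 3 (by decide) (by decide) (by decide)
      · exact hfnot 4 (by decide) (by decide) (by decide)
    · have hxm : x ∈ nbhd G (f i) := mem_nbhd.2 (Or.inr hx.symm)
      have hjm : ∀ k : Fin 6, f (i + k) ∈ ({f (i + 2), f (i + 3), f (i + 4)} : Finset V) ∨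
          f (i + k) ∈ nbhd G (f i) := by
        intro k
        have : k = 0 ∨ k = 1 ∨ k = 5 ∨ k = 2 ∨ k = 3 ∨ k = 4 := by clear * -; revert k; decide
        rcases this with rfl | rfl | rfl | rfl | rfl | rfl
        · exact Or.inr (mem_nbhd.2 (Or.inl hi0))
        · exact Or.inr (mem_nbhd.2 (Or.inr ((hy _).2 (Or.inr (Or.inl rfl)))))
        · exact Or.inr (mem_nbhd.2 (Or.inr ((hy _).2 (Or.inr (Or.inr rfl)))))
        · simp
        · simp
        · simp
      intro c hc w hcw
      simp only [Finset.mem_insert, Finset.mem_singleton] at hc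
      have : w = x ∨ ∃ k, w = f (i + k) := by
        rcases hc with rfl | rfl | rfl
        · exact hcl 2 hbZ w hcw
        · exact hcl 3 hcZ w hcw
        · exact hcl 4 hdZ w hcw
      rcases this with rfl | ⟨k, rfl⟩
      · exact Or.inr hxm
      · exact hjm k
  have hpZ : p ∈ Z := (hZ.closed v hvZ p hvp).resolve_right hpnot
  have hqZ : q ∈ Z := (hZ.closed v hvZ q hvq).resolve_right hqnot
  -- A bad component at `f i` is attached to some neighbour other than x, that is, to `f (i + 1)` or
  -- `f (i + 5)`; all relevant neighbours of these lie in Z.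
  have hZhex : Hex G Z := by
    obtain ⟨K, hK⟩ := M.exists_mem_badComps hyd
    have hKc := (mem_badComps.1 hK).1
    obtain ⟨z, hyz, hzx, c, hcK, hzc⟩ := M.exists_linked_ne hK x
    have hc := (hnot c).1 (hKc.notMem c hcK)
    have hzH : ∃ j : Fin 6, (j = 1 ∨ j = 5) ∧ z = f (i + j) := by
      rcases (hy z).1 hyz with rfl | rfl | rfl
      · exact absurd rfl hzx
      · exact ⟨1, Or.inl rfl, rfl⟩
      · exact ⟨5, Or.inr rfl, rfl⟩
    obtain ⟨j, hj, rfl⟩ := hzH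
    have hcZ' : c ∈ Z := by
      rcases hHc.adj_of_adj (hf.mem _) hzc with h | h
      · obtain ⟨k, rfl⟩ := hf.exists_eq h
        have hk : k = i ∨ k = i + 2 ∨ k = i + 4 := by
          have := (hf.adj _ _).1 hzc
          clear * - this hj
          revert i j k
          decide
        rcases hk with rfl | rfl | rfl
        · exact absurd rfl hc.1
        · exact hbZ
        · exact hdZ
      · rcases (hNv c).1 h with rfl | rfl | rfl
        · exact absurd rfl hc.2.1
        · exact hpZ
        · exact hqZ
    rw [hZ.eq_of_mem hKc hcZ' hcK]
    exact M.hex_of_mem_badComps hyd hK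
  have hZeq : Z = {f (i + 2), f (i + 3), f (i + 4), v, p, q} := by
    symm
    apply Finset.eq_of_subset_of_card_le
    · intro z hz
      simp only [Finset.mem_insert, Finset.mem_singleton] at hz
      rcases hz with rfl | rfl | rfl | rfl | rfl | rfl <;> assumption
    · obtain ⟨g, hg⟩ := hZhex
      rw [hg.card, Finset.card_insert_of_notMem, Finset.card_insert_of_notMem,
        Finset.card_insert_of_notMem, Finset.card_insert_of_notMem, Finset.card_pair hpq]
      · simp [hvp.ne, hvq.ne]
      · simp [hvne, hfne p hvp, hfne q hvq]
      · simp [hvne, hfne p hvp, hfne q hvq, hinj 3 4 (by decide)]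
      · simp [hvne, hfne p hvp, hfne q hvq, hinj 2 3 (by decide), hinj 2 4 (by decide)]
  have hcb := hadj 3 2 (by clear * -; revert i; decide)
  have hcd := hadj 3 4 (by clear * -; revert i; decide)
  have hbd : f (i + 2) ≠ f (i + 4) := hinj 2 4 (by decide)
  have hcp : ¬ G.Adj (f (i + 3)) p := fun h => hZhex.not_three_adj hcZ hbZ hdZ hpZ hcb hcd h hbd
    (hfne p hvp _) (hfne p hvp _)
  have hcq : ¬ G.Adj (f (i + 3)) q := fun h => hZhex.not_three_adj hcZ hbZ hdZ hqZ hcb hcd h hbd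
    (hfne q hvq _) (hfne q hvq _)
  have hpq' : ¬ G.Adj p q := fun h => hZhex.not_triangle hvZ hpZ hqZ hvp h hvq
  -- On the hexagon Z this vertex has a neighbour besides `f (i + 3)`; v is not adjacent to H, so
  -- only p or q is possible.
  have hend : ∀ j : Fin 6, j = 2 ∨ j = 4 → G.Adj (f (i + j)) p ∨ G.Adj (f (i + j)) q := by
    intro j hj
    have hjZ : f (i + j) ∈ Z := by
      rcases hj with rfl | rfl
      · exact hbZ
      · exact hdZ
    obtain ⟨w, hwZ, hwc, hw⟩ := hZhex.exists_adj_ne hjZ (f (i + 3))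
    rw [hZeq] at hwZ
    simp only [Finset.mem_insert, Finset.mem_singleton] at hwZ
    rcases hwZ with rfl | rfl | rfl | rfl | rfl | rfl
    · exact absurd hw (hnadj j 2 (by clear * - hj; revert i j; decide))
    · exact absurd rfl hwc
    · exact absurd hw (hnadj j 4 (by clear * - hj; revert i j; decide))
    · exact absurd hw.symm (hvH _)
    · exact Or.inl hw
    · exact Or.inr hw
  have hboth : ∀ r, r ∈ Z → G.Adj v r → G.Adj (f (i + 2)) r → ¬ G.Adj (f (i + 4)) r :=
    fun r hr hvr h2 h4 => hZhex.not_three_adj hr hvZ hbZ hdZ hvr.symm h2.symm h4.symm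
      (hvne _).symm (hvne _).symm hbd
  rcases hend 2 (Or.inl rfl) with h2 | h2
  · have h4 := (hend 4 (Or.inr rfl)).resolve_left (hboth p hpZ hvp h2)
    exact ⟨p, q, hpq, hpx, hqx, hNv, h2, h4, hpq', hcp, hcq, hZeq ▸ hZ⟩
  · have h4 := (hend 4 (Or.inr rfl)).resolve_right (hboth q hqZ hvq h2)
    refine ⟨q, p, hpq.symm, hqx, hpx, fun w => (hNv w).trans (by rw [or_comm (a := w = p)]), h2,
      h4, fun h => hpq' h.symm, hcq, hcp, ?_⟩
    rw [Finset.pair_comm q p, ← hZeq]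
    exact hZ

/-- Applying the hexagon description at the three attachments x, p and q shows that G has just the
ten vertices of N[v] ∪ H. Two vertices then isolate it, and 28 ≤ 40. -/
theorem degree_le_two (v : V) : G.degree v ≤ 2 := by
  by_contra hv
  have hv3 : G.degree v = 3 := by
    have := M.degree_le_three v
    omega
  obtain ⟨H, hH⟩ := M.exists_mem_badComps (v := v) (by omega)
  have hHc := (mem_badComps.1 hH).1
  obtain ⟨f₀, hf₀⟩ := M.hex_of_mem_badComps (by omega) hH
  obtain ⟨x, hvx, -, c, hc, hxc⟩ := M.exists_linked_ne hH v
  obtain ⟨i, rfl⟩ := hf₀.exists_eq hc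
  obtain ⟨f, hf, hx0⟩ : ∃ f, Labelling G H adjHex f ∧ G.Adj x (f 0) :=
    ⟨_, hf₀.rotate i, by simpa using hxc⟩
  obtain ⟨p, q, hpq, hpx, hqx, hN, h2p, h4q, hnpq, h3p, h3q, hZ0⟩ :=
    M.hexagon_neighborhood hv3 hH hf hvx hx0
  have hvp := (hN p).2 (Or.inr (Or.inl rfl))
  have hvq := (hN q).2 (Or.inr (Or.inr rfl))
  obtain ⟨p₂, q₂, hpq₂, hpx₂, hqx₂, hN₂, -, -, hnpq₂, h3p₂, h3q₂, hZ2⟩ :=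
    M.hexagon_neighborhood hv3 hH hf (i := 0 + 2) hvp h2p.symm
  obtain ⟨p₄, q₄, hpq₄, hpx₄, hqx₄, hN₄, -, -, hnpq₄, h3p₄, h3q₄, hZ4⟩ :=
    M.hexagon_neighborhood hv3 hH hf (i := 0 + 4) hvq h4q.symm
  have hxq : (x = p₂ ∧ q = q₂) ∨ (x = q₂ ∧ q = p₂) := by
    have h1 := (hN₂ x).1 hvx
    have h2 := (hN₂ q).1 hvq
    have h3 : x ≠ p := hpx.symm
    have h4 : q ≠ p := hpq.symm
    have h5 : x ≠ q := hqx.symm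
    rcases h1 with h1 | h1 | h1
    · exact absurd h1 h3
    · rcases h2 with h2 | h2 | h2
      · exact absurd h2 h4
      · exact absurd (h1.trans h2.symm) h5
      · exact Or.inl ⟨h1, h2⟩
    · rcases h2 with h2 | h2 | h2
      · exact absurd h2 h4
      · exact Or.inr ⟨h1, h2⟩
      · exact absurd (h1.trans h2.symm) h5
  have hxp : (x = p₄ ∧ p = q₄) ∨ (x = q₄ ∧ p = p₄) := by
    have h1 := (hN₄ x).1 hvx
    have h2 := (hN₄ p).1 hvp
    rcases h1 with h1 | h1 | h1
    · exact absurd h1 hqx.symm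
    · rcases h2 with h2 | h2 | h2
      · exact absurd h2 hpq
      · exact absurd (h1.trans h2.symm) hpx.symm
      · exact Or.inl ⟨h1, h2⟩
    · rcases h2 with h2 | h2 | h2
      · exact absurd h2 hpq
      · exact Or.inr ⟨h1, h2⟩
      · exact absurd (h1.trans h2.symm) hpx.symm
  -- These are the positions opposite the base points 2 and 4: 2 + 3 = 5 and 4 + 3 = 1 in `Fin 6`.
  have h5q : ¬ G.Adj (f 5) q := by
    rcases hxq with ⟨-, rfl⟩ | ⟨-, rfl⟩
    · exact h3q₂
    · exact h3p₂
  have h1p : ¬ G.Adj (f 1) p := by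
    rcases hxp with ⟨-, rfl⟩ | ⟨-, rfl⟩
    · exact h3q₄
    · exact h3p₄
  have hmemS : ∀ w, w ∈ H ∨ G.Adj v w → w ∈ insert v (insert x (insert p (insert q H))) := by
    intro w hw
    simp only [Finset.mem_insert]
    rcases hw with h | h
    · tauto
    · rcases (hN w).1 h with e | e | e <;> simp [e]
  have hall : insert v (insert x (insert p (insert q H))) = Finset.univ := by
    have hout : ∀ {j : Fin 6} {Z : Finset V} {z w : V}, IsComp G (nbhd G (f j)) Z → z ∈ Z →
        (∀ y ∈ Z, y = v ∨ y ∈ H ∨ G.Adj v y) → G.Adj z w →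
        w ∈ insert v (insert x (insert p (insert q H))) := by
      intro j Z z w hZ hz hsub hzw
      rcases hZ.adj_of_adj hz hzw with h | h
      · rcases hsub w h with rfl | h
        · simp
        · exact hmemS w h
      · exact hmemS w (hHc.adj_of_adj (hf.mem j) h)
    have hsub0 : ∀ y ∈ ({f (0 + 2), f (0 + 3), f (0 + 4), v, p, q} : Finset V),
        y = v ∨ y ∈ H ∨ G.Adj v y := by
      intro y hy
      simp only [Finset.mem_insert, Finset.mem_singleton] at hy
      rcases hy with rfl | rfl | rfl | rfl | rfl | rfl
      · exact Or.inr (Or.inl (hf.mem _))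
      · exact Or.inr (Or.inl (hf.mem _))
      · exact Or.inr (Or.inl (hf.mem _))
      · exact Or.inl rfl
      · exact Or.inr (Or.inr ((hN _).2 (by simp)))
      · exact Or.inr (Or.inr ((hN _).2 (by simp)))
    refine eq_univ_of_closed M.connected (by simp) ?_
    intro a ha w haw
    have ha' : a = v ∨ a = x ∨ a = p ∨ a = q ∨ a ∈ H := by simpa using ha
    rcases ha' with rfl | rfl | rfl | rfl | ha'
    · exact hmemS w (Or.inr haw)
    · refine hout hZ2 (z := a) (by rcases hxq with ⟨h, -⟩ | ⟨h, -⟩ <;> simp [h]) ?_ haw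
      intro y hy
      simp only [Finset.mem_insert, Finset.mem_singleton] at hy
      rcases hy with rfl | rfl | rfl | rfl | rfl | rfl
      · exact Or.inr (Or.inl (hf.mem _))
      · exact Or.inr (Or.inl (hf.mem _))
      · exact Or.inr (Or.inl (hf.mem _))
      · exact Or.inl rfl
      · exact Or.inr (Or.inr ((hN₂ _).2 (by simp)))
      · exact Or.inr (Or.inr ((hN₂ _).2 (by simp)))
    · exact hout hZ0 (z := a) (by simp) hsub0 haw
    · exact hout hZ0 (z := a) (by simp) hsub0 haw
    · exact hmemS w (hHc.adj_of_adj ha' haw)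
  have hfne : ∀ w, G.Adj v w → w ∉ H := fun w hw hm => hHc.not_adj hm hw
  have hcard : (Finset.univ : Finset V).card = 10 := by
    rw [← hall, Finset.card_insert_of_notMem, Finset.card_insert_of_notMem,
      Finset.card_insert_of_notMem, Finset.card_insert_of_notMem (hfne q hvq), hf.card]
    · simp [hpq, hfne p hvp]
    · simp [hpx.symm, hqx.symm, hfne x hvx]
    · simp only [Finset.mem_insert, not_or]
      exact ⟨hvx.ne, hvp.ne, hvq.ne, fun h => hHc.ne h rfl⟩
  -- Only `f 1`, `f 5`, p and q can stay undominated, and the only possible edges among them are the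
  -- disjoint pairs `f 1`, q and `f 5`, p.
  refine M.false_of_isolates (D := {x, f 3}) ?_ ?_
  · have d1 : ∀ w, G.Adj x w → Dominates G {x, f 3} w := fun w hw =>
      dominates_of_adj (v := x) (by simp) hw
    have d2 : ∀ w, G.Adj (f 3) w → Dominates G {x, f 3} w := fun w hw =>
      dominates_of_adj (v := f 3) (by simp) hw
    have hund : ∀ w, ¬ Dominates G {x, f 3} w → w = f 1 ∨ w = f 5 ∨ w = p ∨ w = q := by
      intro w hw
      have hwm := Finset.mem_univ w
      rw [← hall] at hwm
      simp only [Finset.mem_insert] at hwm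
      rcases hwm with rfl | rfl | rfl | rfl | h
      · exact absurd (d1 _ hvx.symm) hw
      · exact absurd (dominates_self (by simp)) hw
      · simp
      · simp
      · obtain ⟨j, rfl⟩ := hf.exists_eq h
        have : j = 0 ∨ j = 1 ∨ j = 2 ∨ j = 3 ∨ j = 4 ∨ j = 5 := by clear * -; revert j; decide
        rcases this with rfl | rfl | rfl | rfl | rfl | rfl
        · exact absurd (d1 _ hx0) hw
        · simp
        · exact absurd (d2 _ ((hf.adj _ _).2 (by decide))) hw
        · exact absurd (dominates_self (by simp)) hw
        · exact absurd (d2 _ ((hf.adj _ _).2 (by decide))) hw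
        · simp
    have h15 : ¬ G.Adj (f 1) (f 5) := by
      rw [hf.adj]
      decide
    have key : ∀ a b, ¬ Dominates G {x, f 3} a → ¬ Dominates G {x, f 3} b → G.Adj b a →
        (b = f 1 ∧ a = q) ∨ (b = q ∧ a = f 1) ∨ (b = f 5 ∧ a = p) ∨ (b = p ∧ a = f 5) := by
      intro a b ha hb hba
      rcases hund b hb with rfl | rfl | rfl | rfl <;> rcases hund a ha with rfl | rfl | rfl | rfl
      · exact absurd rfl hba.ne
      · exact absurd hba h15
      · exact absurd hba h1p
      · simp
      · exact absurd hba.symm h15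
      · exact absurd rfl hba.ne
      · simp
      · exact absurd hba h5q
      · exact absurd hba.symm h1p
      · simp
      · exact absurd rfl hba.ne
      · exact absurd hba hnpq
      · simp
      · exact absurd hba.symm h5q
      · exact absurd hba.symm hnpq
      · exact absurd rfl hba.ne
    have n15 : f 1 ≠ f 5 := hf.inj.ne (by decide)
    have nq : ∀ j, f j ≠ q := fun j e => hfne q hvq (e ▸ hf.mem j)
    have np : ∀ j, f j ≠ p := fun j e => hfne p hvp (e ▸ hf.mem j)
    apply isolates_univ
    intro a b c ha hb hc hba hbc
    have h1 := key a b ha hb hba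
    have h2 := key c b hc hb hbc
    rcases h1 with ⟨rfl, rfl⟩ | ⟨rfl, rfl⟩ | ⟨rfl, rfl⟩ | ⟨rfl, rfl⟩ <;>
      rcases h2 with ⟨e, rfl⟩ | ⟨e, rfl⟩ | ⟨e, rfl⟩ | ⟨e, rfl⟩ <;>
      first
        | rfl
        | exact absurd e (nq _)
        | exact absurd e (np _)
        | exact absurd e n15
        | exact absurd e.symm n15
        | exact absurd e.symm (nq _)
        | exact absurd e.symm (np _)
        | exact absurd e hpq
        | exact absurd e.symm hpq
  · have h2 : (({x, f 3} : Finset V).card : ℤ) ≤ 2 := by exact_mod_cast Finset.card_le_two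
    rw [M.wt_eq, hcard]
    omega

end MinimalCounterexample

end Cubic

end GraphIsolation

namespace GraphIsolation

universe u

/-! ### The 2-regular case -/

section UpperBound

open scoped Classical

variable {V : Type u} [Fintype V] {G : SimpleGraph V}

namespace MinimalCounterexample

variable (M : MinimalCounterexample G)

include M

theorem degree_eq_two (v : V) : G.degree v = 2 := by
  by_contra hv
  have h1 := M.degree_ne_one v
  have h2 := M.degree_le_two v
  have h0 : G.degree v = 0 := by omega
  have huniv : ∀ w, w = v := fun w => by
    by_contra hw
    exact M.card_pos_degree v hw h0
  refine M.false_of_isolates (D := ∅) (isolates_of_card_le_two ?_ _) (by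
    simpa using wt_nonneg Finset.univ)
  have : (Finset.univ : Finset V) ⊆ {v} := fun w _ => by simp [huniv w]
  exact (Finset.card_le_card this).trans (by simp)

/-- The ends of the path have further neighbours p and q, both adjacent to v. By 2-regularity these
six vertices close up to C₆. -/
theorem false_of_path_component {v : V} {C : Finset V} (hC : IsComp G (nbhd G v) C)
    {f : Fin 3 → V} (hf : Labelling G C adjP3 f) : False := by
  have h01 : G.Adj (f 0) (f 1) := (hf.adj _ _).2 (by decide)
  have h12 : G.Adj (f 1) (f 2) := (hf.adj _ _).2 (by decide)
  have h02 : ¬ G.Adj (f 0) (f 2) := by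
    rw [hf.adj]
    decide
  have h02' : f 0 ≠ f 2 := hf.inj.ne (by decide)
  have hmem : ∀ w, w ∈ C → w = f 0 ∨ w = f 1 ∨ w = f 2 := by
    intro w hw
    obtain ⟨i, rfl⟩ := hf.exists_eq hw
    have : i = 0 ∨ i = 1 ∨ i = 2 := by clear * -; revert i; decide
    rcases this with rfl | rfl | rfl <;> simp
  obtain ⟨p, hp1, hp⟩ := exists_adj_iff_of_degree_eq_two (M.degree_eq_two (f 0)) h01
  obtain ⟨q, hq1, hq⟩ := exists_adj_iff_of_degree_eq_two (M.degree_eq_two (f 2)) h12.symm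
  have h0p := (hp p).2 (Or.inr rfl)
  have h2q := (hq q).2 (Or.inr rfl)
  have hpC : p ∉ C := by
    intro h
    rcases hmem p h with rfl | rfl | rfl
    · exact h0p.ne rfl
    · exact hp1 rfl
    · exact h02 h0p
  have hqC : q ∉ C := by
    intro h
    rcases hmem q h with rfl | rfl | rfl
    · exact h02 h2q.symm
    · exact hq1 rfl
    · exact h2q.ne rfl
  have hvp : G.Adj v p := (hC.adj_of_adj (hf.mem 0) h0p).resolve_left hpC
  have hvq : G.Adj v q := (hC.adj_of_adj (hf.mem 2) h2q).resolve_left hqC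
  have hvC : v ∉ C := fun h => hC.ne h rfl
  have hvf : ∀ i, v ≠ f i := fun i e => hvC (e ▸ hf.mem i)
  have hpf : ∀ i, p ≠ f i := fun i e => hpC (e ▸ hf.mem i)
  have hqf : ∀ i, q ≠ f i := fun i e => hqC (e ▸ hf.mem i)
  have hpadj := adj_iff_of_degree_eq_two (M.degree_eq_two p) hvp.symm h0p.symm (hvf 0)
  have hpq : p ≠ q := by
    rintro rfl
    rcases (hpadj _).1 h2q.symm with h | h
    · exact hvf 2 h.symm
    · exact h02' h.symm
  have hqadj := adj_iff_of_degree_eq_two (M.degree_eq_two q) hvq.symm h2q.symm (hvf 2)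
  have hvadj := adj_iff_of_degree_eq_two (M.degree_eq_two v) hvp hvq hpq
  have h1adj := adj_iff_of_degree_eq_two (M.degree_eq_two (f 1)) h01.symm h12 h02'
  have huniv : ({v, p, f 0, f 1, f 2, q} : Finset V) = Finset.univ := by
    refine eq_univ_of_closed M.connected (by simp) ?_
    intro s hs w hsw
    simp only [Finset.mem_insert, Finset.mem_singleton] at hs
    rcases hs with rfl | rfl | rfl | rfl | rfl | rfl
    · rcases (hvadj w).1 hsw with e | e <;> simp [e]
    · rcases (hpadj w).1 hsw with e | e <;> simp [e]
    · rcases (hp w).1 hsw with e | e <;> simp [e]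
    · rcases (h1adj w).1 hsw with e | e <;> simp [e]
    · rcases (hq w).1 hsw with e | e <;> simp [e]
    · rcases (hqadj w).1 hsw with e | e <;> simp [e]
  have h01' := h01.ne
  have h12' := h12.ne
  have hlab : Labelling G Finset.univ adjHex ![v, p, f 0, f 1, f 2, q] := by
    refine ⟨?_, ?_, ?_⟩
    · intro i j
      fin_cases i <;> fin_cases j <;>
        simp [hvf, hpf, hqf, (hvf _).symm, (hpf _).symm, (hqf _).symm, hpq, hpq.symm, hvp.ne,
          hvp.ne', hvq.ne, hvq.ne', h01', h01'.symm, h12', h12'.symm, h02', h02'.symm]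
    · rw [← huniv]
      ext w
      simp [Fin.exists_fin_succ, eq_comm]
    · intro i j
      fin_cases i <;> fin_cases j <;>
        simp [adjHex, hvadj, hpadj, hqadj, hp, hq, h1adj, hvf, hpf, hqf, (hvf _).symm,
          (hpf _).symm, (hqf _).symm, hpq, hpq.symm, hvp.ne, hvp.ne', hvq.ne, hvq.ne', h01',
          h01'.symm, h12', h12'.symm, h02', h02'.symm]
  exact M.not_isSGraph (Or.inr (Or.inr (Or.inr (Or.inl (hlab.nonempty_iso cycleGraph_six_adj)))))

theorem not_three_adj {v a b c : V} (ha : G.Adj v a) (hb : G.Adj v b) (hc : G.Adj v c)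
    (hab : a ≠ b) (hac : a ≠ c) (hbc : b ≠ c) : False := by
  rcases (adj_iff_of_degree_eq_two (M.degree_eq_two v) ha hb hab c).1 hc with h | h
  · exact hac h.symm
  · exact hbc h.symm

/-- Some vertex of C has a neighbour outside and hence at most one inside, which excludes K₃ and C₆;
the star, C₆' and C₆'' contain a vertex of degree 3. -/
theorem not_isSGraph_component {v : V} {C : Finset V} (hC : IsComp G (nbhd G v) C) :
    ¬ IsSGraph (G.induce (C : Set V)) := by
  have hreg : ∀ {k : ℕ} {R : Fin k → Fin k → Bool} {f : Fin k → V}, Labelling G C R f →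
      (∀ i, ∃ a b, R i a = true ∧ R i b = true ∧ a ≠ b) → False := by
    intro k R f hf h
    obtain ⟨c, hc, x, hx, hcx⟩ := hC.exists_adj M.connected (nbhd_nonempty v)
    obtain ⟨i, rfl⟩ := hf.exists_eq hc
    obtain ⟨a, b, ha, hb, hab⟩ := h i
    have hxC : x ∉ C := fun h => hC.notMem x h hx
    exact M.not_three_adj ((hf.adj _ _).2 ha) ((hf.adj _ _).2 hb) hcx (hf.inj.ne hab)
      (fun e => hxC (e ▸ hf.mem a)) (fun e => hxC (e ▸ hf.mem b))
  have hthree : ∀ {k : ℕ} {R : Fin k → Fin k → Bool} {f : Fin k → V}, Labelling G C R f →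
      ∀ i a b c, R i a = true → R i b = true → R i c = true → a ≠ b → a ≠ c → b ≠ c → False := by
    intro k R f hf i a b c ha hb hc hab hac hbc
    exact M.not_three_adj ((hf.adj _ _).2 ha) ((hf.adj _ _).2 hb) ((hf.adj _ _).2 hc)
      (hf.inj.ne hab) (hf.inj.ne hac) (hf.inj.ne hbc)
  rintro (⟨⟨e⟩⟩ | ⟨⟨e⟩⟩ | ⟨⟨e⟩⟩ | ⟨⟨e⟩⟩ | ⟨⟨e⟩⟩ | ⟨⟨e⟩⟩)
  · obtain ⟨f, hf⟩ := exists_labelling e adjP3 pathGraph_three_adj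
    exact M.false_of_path_component hC hf
  · obtain ⟨f, hf⟩ := exists_labelling e adjK3 top_three_adj
    exact hreg hf (by decide)
  · obtain ⟨f, hf⟩ := exists_labelling e adjStar starGraph_four_adj
    exact hthree hf 0 1 2 3 (by decide) (by decide) (by decide) (by decide) (by decide) (by decide)
  · obtain ⟨f, hf⟩ := exists_labelling e adjHex cycleGraph_six_adj
    exact hreg hf (by decide)
  · obtain ⟨f, hf⟩ := exists_labelling e adjC6' C6'_adj
    exact hthree hf 0 1 5 6 (by decide) (by decide) (by decide) (by decide) (by decide) (by decide)
  · obtain ⟨f, hf⟩ := exists_labelling e adjC6'' C6''_adj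
    exact hthree hf 0 1 5 6 (by decide) (by decide) (by decide) (by decide) (by decide) (by decide)

/-- The vertices p and q lose a neighbour when N[v] is deleted and become leaves of their component.
Minimality counts the leaves of the induced subgraph, and this gains one unit for each of them. -/
theorem exists_isolates_component {v a b p q : V} (hva : G.Adj v a) (hvb : G.Adj v b)
    (hab : a ≠ b) (hap : G.Adj a p) (hbq : G.Adj b q) {C : Finset V}
    (hC : IsComp G (nbhd G v) C) :
    ∃ D, Isolates G C D ∧ 14 * (D.card : ℤ) +
      ((if p ∈ C then 1 else 0) + if q ∈ C then 1 else 0) ≤ wt G C := by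
  rw [M.wt_eq]
  by_cases hC1 : C.card ≤ 1
  · refine ⟨∅, isolates_of_card_le_two (by omega) _, ?_⟩
    have := Finset.card_pos.2 hC.conn.1
    simp only [Finset.card_empty]
    split_ifs <;> omega
  · have hne : C ≠ Finset.univ := by
      rintro rfl
      exact hC.notMem v (Finset.mem_univ v) (mem_nbhd.2 (Or.inl rfl))
    obtain ⟨D, hD, hcard⟩ := (M.induct C hC.conn hne).resolve_right (M.not_isSGraph_component hC)
    refine ⟨D, hD, ?_⟩
    have haC : a ∉ C := fun h => hC.not_adj h hva
    have hbC : b ∉ C := fun h => hC.not_adj h hvb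
    have hleaf : ∀ {p a}, a ∉ C → G.Adj a p → p ∈ C →
        (∃ c ∈ C, G.Adj p c ∧ ∀ w, G.Adj p w ↔ w = a ∨ w = c) ∧
        (G.neighborFinset p ∩ C).card = 1 := by
      intro p a haC hap hp
      obtain ⟨d, hd, hdp⟩ := Finset.exists_mem_ne (by omega : 1 < C.card) p
      obtain ⟨c, hc, hpc⟩ := hC.conn.exists_adj hp hd hdp.symm
      have hiff := adj_iff_of_degree_eq_two (M.degree_eq_two p) hap.symm hpc
        (fun e => haC (e ▸ hc))
      refine ⟨⟨c, hc, hpc, hiff⟩, Finset.card_eq_one.2 ⟨c, ?_⟩⟩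
      ext w
      simp only [Finset.mem_inter, SimpleGraph.mem_neighborFinset, hiff, Finset.mem_singleton]
      constructor
      · rintro ⟨rfl | rfl, hw⟩
        · exact absurd hw haC
        · rfl
      · rintro rfl
        exact ⟨Or.inr rfl, hc⟩
    have hsub : ({p, q} : Finset V).filter (· ∈ C) ⊆
        C.filter fun c => (G.neighborFinset c ∩ C).card = 1 := by
      intro w hw
      simp only [Finset.mem_filter, Finset.mem_insert, Finset.mem_singleton] at hw ⊢
      rcases hw with ⟨rfl | rfl, hw⟩
      · exact ⟨hw, (hleaf haC hap hw).2⟩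
      · exact ⟨hw, (hleaf hbC hbq hw).2⟩
    have hpq : p ∈ C → p ≠ q := by
      rintro hp rfl
      obtain ⟨⟨c, hc, hpc, hiff⟩, -⟩ := hleaf haC hap hp
      rcases (hiff b).1 hbq.symm with h | h
      · exact hab h.symm
      · exact hbC (h ▸ hc)
    have h1 := Finset.card_le_card hsub
    have h2 : ((({p, q} : Finset V).filter (· ∈ C)).card : ℤ) =
        (if p ∈ C then 1 else 0) + if q ∈ C then 1 else 0 := by
      by_cases hp : p ∈ C
      · rw [Finset.card_filter, Finset.sum_pair (hpq hp)]
        push_cast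
        rfl
      · rw [Finset.filter_insert, if_neg hp, Finset.filter_singleton]
        split_ifs <;> simp
    rw [← h2]
    omega

/-- If the neighbours of v are adjacent, G is a triangle. Otherwise N[v] weighs 12, and the two
units gained at p and q complete 14. -/
theorem false : False := by
  obtain ⟨v⟩ := M.connected.nonempty
  obtain ⟨a, b, hab, hN⟩ := Finset.card_eq_two.1
    ((G.card_neighborFinset_eq_degree v).trans (M.degree_eq_two v))
  have hadj : ∀ w, G.Adj v w ↔ w = a ∨ w = b := by
    intro w
    rw [← SimpleGraph.mem_neighborFinset, hN]
    simp
  have hva := (hadj a).2 (Or.inl rfl)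
  have hvb := (hadj b).2 (Or.inr rfl)
  obtain ⟨p, hpv, hp⟩ := exists_adj_iff_of_degree_eq_two (M.degree_eq_two a) hva.symm
  obtain ⟨q, hqv, hq⟩ := exists_adj_iff_of_degree_eq_two (M.degree_eq_two b) hvb.symm
  have hap := (hp p).2 (Or.inr rfl)
  have hbq := (hq q).2 (Or.inr rfl)
  by_cases hadjab : G.Adj a b
  · have ha' := adj_iff_of_degree_eq_two (M.degree_eq_two a) hva.symm hadjab hvb.ne
    have hb' := adj_iff_of_degree_eq_two (M.degree_eq_two b) hvb.symm hadjab.symm hva.ne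
    have huniv : ({v, a, b} : Finset V) = Finset.univ := by
      refine eq_univ_of_closed M.connected (by simp) ?_
      intro s hs w hsw
      simp only [Finset.mem_insert, Finset.mem_singleton] at hs
      rcases hs with rfl | rfl | rfl
      · rcases (hadj w).1 hsw with e | e <;> simp [e]
      · rcases (ha' w).1 hsw with e | e <;> simp [e]
      · rcases (hb' w).1 hsw with e | e <;> simp [e]
    have hlab : Labelling G Finset.univ adjK3 ![v, a, b] := by
      refine ⟨?_, ?_, ?_⟩
      · intro i j
        fin_cases i <;> fin_cases j <;> simp [hva.ne, hva.ne', hvb.ne, hvb.ne', hab, hab.symm]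
      · rw [← huniv]
        ext w
        simp [Fin.exists_fin_succ, eq_comm]
      · intro i j
        fin_cases i <;> fin_cases j <;>
          simp [adjK3, hva, hva.symm, hvb, hvb.symm, hadjab, hadjab.symm]
    exact M.not_isSGraph (Or.inr (Or.inl (hlab.nonempty_iso top_three_adj)))
  · have hpn : p ∉ nbhd G v := by
      rw [mem_nbhd, hadj]
      rintro (h | h | h)
      · exact hpv h
      · exact hap.ne h.symm
      · exact hadjab (h ▸ hap)
    have hqn : q ∉ nbhd G v := by
      rw [mem_nbhd, hadj]
      rintro (h | h | h)
      · exact hqv h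
      · exact hadjab (h ▸ hbq.symm)
      · exact hbq.ne h.symm
    obtain ⟨A, hA, hpA⟩ := exists_isComp _ hpn
    obtain ⟨B, hB, hqB⟩ := exists_isComp _ hqn
    have h1 := M.wt_nbhd_lt v (A := ∅) (by simp)
      (fun C => (if p ∈ C then 1 else 0) + if q ∈ C then 1 else 0) (by
        intro C hC
        obtain ⟨D, hD, hc⟩ := M.exists_isolates_component hva hvb hab hap hbq hC
        exact ⟨D, hD.mono (Finset.filter_subset _ _) le_rfl, hc⟩)
    have h2 : ∀ {r : V} {C : Finset V}, IsComp G (nbhd G v) C → r ∈ C →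
        (1 : ℤ) ≤ ∑ C ∈ comps G (nbhd G v), if r ∈ C then 1 else 0 := by
      intro r C hC hr
      have := Finset.single_le_sum (f := fun C : Finset V => if r ∈ C then (1 : ℤ) else 0)
        (fun C _ => by split_ifs <;> norm_num) (mem_comps.2 hC)
      simpa [hr] using this
    have h3 := h2 hA hpA
    have h4 := h2 hB hqB
    have hw : wt G (nbhd G v) = 12 := by
      rw [M.wt_eq, nbhd, Finset.card_insert_of_notMem (by simp),
        SimpleGraph.card_neighborFinset_eq_degree, M.degree_eq_two]
      norm_num
    rw [Finset.sum_add_distrib, hw, Finset.card_empty] at h1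
    push_cast at h1
    linarith

end MinimalCounterexample

/-! ### Induction on the number of vertices and the upper bound -/

theorem degree_induce (C : Finset V) (c : (C : Set V)) :
    (G.induce (C : Set V)).degree c = (G.neighborFinset c ∩ C).card := by
  rw [← SimpleGraph.card_neighborFinset_eq_degree,
    ← Finset.card_map (Function.Embedding.subtype (· ∈ (C : Set V)))]
  congr 1
  ext w
  simp only [Finset.mem_map, SimpleGraph.mem_neighborFinset, Finset.mem_inter,
    Function.Embedding.subtype_apply]
  constructor
  · rintro ⟨z, hz, rfl⟩
    exact ⟨hz, z.2⟩
  · rintro ⟨h1, h2⟩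
    exact ⟨⟨w, h2⟩, h1, rfl⟩

theorem exists_isolates_of_goodSet_induce {C : Finset V}
    (h : GoodSet (G.induce (C : Set V)) Finset.univ) :
    ∃ D, Isolates G C D ∧
      14 * D.card + (C.filter fun c => (G.neighborFinset c ∩ C).card = 1).card ≤ 4 * C.card := by
  obtain ⟨D, hD, hcard⟩ := h
  refine ⟨D.map (Function.Embedding.subtype (· ∈ (C : Set V))), ?_, ?_⟩
  · have hdom : ∀ c : (C : Set V), Dominates (G.induce (C : Set V)) D c →
        Dominates G (D.map (Function.Embedding.subtype (· ∈ (C : Set V)))) c := by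
      rintro c ⟨d, hd, h⟩
      refine ⟨d, Finset.mem_map_of_mem _ hd, ?_⟩
      rcases h with rfl | h
      · exact Or.inl rfl
      · exact Or.inr h
    intro a ha b hb c hc hac hab hbc
    rcases hD ⟨a, ha⟩ (Finset.mem_univ _) ⟨b, hb⟩ (Finset.mem_univ _) ⟨c, hc⟩ (Finset.mem_univ _)
      (fun e => hac (congrArg Subtype.val e)) hab hbc with h | h | h
    · exact Or.inl (hdom _ h)
    · exact Or.inr (Or.inl (hdom _ h))
    · exact Or.inr (Or.inr (hdom _ h))
  · have h1 : (Finset.univ : Finset (C : Set V)).card = C.card := by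
      rw [Finset.card_univ]
      simp
    have h2 : (Finset.univ.filter fun c => (G.induce (C : Set V)).degree c = 1).card =
        (C.filter fun c => (G.neighborFinset c ∩ C).card = 1).card := by
      rw [← Finset.card_map (Function.Embedding.subtype (· ∈ (C : Set V)))]
      congr 1
      ext w
      simp only [Finset.mem_map, Finset.mem_filter, Finset.mem_univ, true_and, degree_induce,
        Function.Embedding.subtype_apply]
      constructor
      · rintro ⟨z, hz, rfl⟩
        exact ⟨z.2, hz⟩
      · rintro ⟨h1, h2⟩
        exact ⟨⟨w, h1⟩, h2, rfl⟩
    have h3 : wt (G.induce (C : Set V)) Finset.univ =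
        4 * C.card - (C.filter fun c => (G.neighborFinset c ∩ C).card = 1).card := by
      rw [wt_eq_sub, h1, ← h2]
      congr!
    rw [h3] at hcard
    rw [Finset.card_map]
    omega

theorem goodSet_univ (n : ℕ) : ∀ (V : Type u) [Fintype V] (G : SimpleGraph V),
    Fintype.card V = n → G.Connected → ¬ IsSGraph G → GoodSet G Finset.univ := by
  induction n using Nat.strong_induction_on with
  | _ n ih =>
    intro V _ G hn hconn hS
    by_contra hbad
    refine MinimalCounterexample.false ⟨hconn, hS, hbad, fun C hC hne => ?_⟩
    by_cases hCS : IsSGraph (G.induce (C : Set V))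
    · exact Or.inr hCS
    · refine Or.inl (exists_isolates_of_goodSet_induce (ih C.card ?_ _ _ ?_ hC.connected_induce hCS))
      · rw [← hn]
        exact Finset.card_lt_card (Finset.ssubset_univ_iff.2 hne)
      · simp

theorem leafCount_eq (G : SimpleGraph V) :
    leafCount G = (Finset.univ.filter fun v => G.degree v = 1).card := by
  rw [leafCount, leaves, ← Set.ncard_coe_finset]
  congr 1
  ext v
  simp only [Set.mem_ofPred_eq, Finset.coe_filter, Finset.mem_univ, true_and]
  rw [← SimpleGraph.card_neighborFinset_eq_degree, ← Set.ncard_coe_finset,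
    SimpleGraph.coe_neighborFinset]

theorem isolationNumber_two_le (G : SimpleGraph V) (hG : G.Connected) (hS : ¬ IsSGraph G) :
    (isolationNumber 2 G : ℤ) ≤ ⌊(4 * (Fintype.card V : ℚ) - (leafCount G : ℚ)) / 14⌋ := by
  obtain ⟨D, hD, hcard⟩ := goodSet_univ _ V G rfl hG hS
  have h1 := isolationNumber_le hD
  rw [wt_eq_sub, ← leafCount_eq, Finset.card_univ] at hcard
  rw [Int.le_floor, le_div_iff₀ (by norm_num)]
  have h2 : (isolationNumber 2 G : ℤ) * 14 ≤ 4 * (Fintype.card V : ℤ) - leafCount G := by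
    have : (isolationNumber 2 G : ℤ) ≤ D.card := by exact_mod_cast h1
    linarith
  exact_mod_cast h2

end UpperBound

end GraphIsolation

namespace GraphIsolation

universe u

/-! ### Sharpness: the graphs B'ₙ -/

section Extremal

open scoped Classical

theorem Labelling.of_card {V : Type u} [Fintype V] {G : SimpleGraph V} {k : ℕ}
    {R : Fin k → Fin k → Bool} {f : Fin k → V} (hV : Fintype.card V = k)
    (hf : Function.Injective f) (hR : ∀ i j, G.Adj (f i) (f j) ↔ R i j = true) :
    Labelling G Finset.univ R f := by
  refine ⟨hf, ?_, hR⟩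
  symm
  rw [← Finset.card_eq_iff_eq_univ, Finset.card_image_of_injective _ hf, hV, Finset.card_univ,
    Fintype.card_fin]

variable {n : ℕ}

theorem BGraph_adj (x y : BVert n) : (BGraph n).Adj x y ↔ x ≠ y ∧ (BRel n x y ∨ BRel n y x) :=
  SimpleGraph.fromRel_adj _ _ _

theorem BGraph_adj_inr_end (m : Fin (n / 4)) {x : Fin 3} (hx : x ≠ 1) (w : BVert n) :
    (BGraph n).Adj (Sum.inr (m, x)) w ↔ w = Sum.inr (m, 1) := by
  rw [BGraph_adj]
  rcases w with i | ⟨l, y⟩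
  · simp [BRel, hx]
  · simp only [BRel, ne_eq, Sum.inr.injEq, Prod.mk.injEq]
    constructor
    · rintro ⟨-, ⟨rfl, h⟩ | ⟨rfl, h⟩⟩ <;> refine ⟨rfl, ?_⟩ <;> clear * - h hx <;> revert x y <;>
        decide
    · rintro ⟨rfl, rfl⟩
      refine ⟨fun h => hx h.2, ?_⟩
      have : (x : ℕ) + 1 = ((1 : Fin 3) : ℕ) ∨ ((1 : Fin 3) : ℕ) + 1 = (x : ℕ) := by
        clear * - hx
        revert x
        decide
      rcases this with h | h
      · exact Or.inl ⟨rfl, h⟩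
      · exact Or.inr ⟨rfl, h⟩

theorem BGraph_reachable_inl (hn : 1 ≤ n) (j : ℕ) (hj : j < n - 3 * (n / 4)) :
    (BGraph n).Reachable (Sum.inl ⟨0, by omega⟩) (Sum.inl ⟨j, hj⟩) := by
  induction j using Nat.strong_induction_on with
  | _ j ih =>
    rcases Nat.eq_zero_or_pos j with rfl | hpos
    · exact SimpleGraph.Reachable.refl _
    · obtain ⟨k, hk, hadj⟩ : ∃ k, k < j ∧ ((n ≤ 3 ∧ k + 1 = j) ∨
          (4 ≤ n ∧ k + 1 = j ∧ j < n / 4) ∨ (4 ≤ n ∧ k + 1 = n / 4 ∧ n / 4 ≤ j)) := by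
        by_cases h : 4 ≤ n ∧ n / 4 ≤ j
        · exact ⟨n / 4 - 1, by omega, by omega⟩
        · exact ⟨j - 1, by omega, by omega⟩
      refine (ih k hk (hk.trans hj)).trans (SimpleGraph.Adj.reachable ?_)
      rw [BGraph_adj]
      refine ⟨?_, Or.inl hadj⟩
      simp only [ne_eq, Sum.inl.injEq, Fin.mk.injEq]
      omega

theorem BGraph_connected (hn : 1 ≤ n) : (BGraph n).Connected := by
  have hroot : ∀ x, (BGraph n).Reachable (Sum.inl ⟨0, by omega⟩) x := by
    have hmid : ∀ m : Fin (n / 4),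
        (BGraph n).Reachable (Sum.inl ⟨0, by omega⟩) (Sum.inr (m, 1)) := by
      intro m
      have hm := m.2
      refine (BGraph_reachable_inl hn m (by omega)).trans (SimpleGraph.Adj.reachable ?_)
      rw [BGraph_adj]
      exact ⟨by simp, Or.inl ⟨rfl, rfl⟩⟩
    rintro (⟨j, hj⟩ | ⟨m, x⟩)
    · exact BGraph_reachable_inl hn j hj
    · by_cases hx : x = 1
      · exact hx ▸ hmid m
      · exact (hmid m).trans ((BGraph_adj_inr_end m hx _).2 rfl).symm.reachable
  have : Nonempty (BVert n) := ⟨Sum.inl ⟨0, by omega⟩⟩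
  exact ⟨fun x y => (hroot x).symm.trans (hroot y)⟩

theorem isSGraph_BGraph_three : IsSGraph (BGraph 3) := by
  have h : Labelling (BGraph 3) Finset.univ adjP3
      ![Sum.inl ⟨0, by norm_num⟩, Sum.inl ⟨1, by norm_num⟩, Sum.inl ⟨2, by norm_num⟩] := by
    refine Labelling.of_card (card_BVert _) ?_ ?_
    · intro i j
      fin_cases i <;> fin_cases j <;> simp
    · intro i j
      fin_cases i <;> fin_cases j <;> simp [BGraph_adj, BRel, adjP3]
  exact Or.inl (h.nonempty_iso pathGraph_three_adj)

theorem isSGraph_BGraph_four : IsSGraph (BGraph 4) := by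
  have h : Labelling (BGraph 4) Finset.univ adjStar
      ![Sum.inr (⟨0, by norm_num⟩, 1), Sum.inl ⟨0, by norm_num⟩, Sum.inr (⟨0, by norm_num⟩, 0),
        Sum.inr (⟨0, by norm_num⟩, 2)] := by
    refine Labelling.of_card (card_BVert _) ?_ ?_
    · intro i j
      fin_cases i <;> fin_cases j <;> simp
    · intro i j
      fin_cases i <;> fin_cases j <;> simp [BGraph_adj, BRel, adjStar]
  exact Or.inr (Or.inr (Or.inl (h.nonempty_iso starGraph_four_adj)))

/-- The two ends of F₀ have a single neighbour, so both would have to map to the one vertex z that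
may lack two neighbours. -/
theorem not_nonempty_iso_BGraph (hn : 4 ≤ n) {k : ℕ} {Γ : SimpleGraph (Fin k)}
    {R : Fin k → Fin k → Bool} (hR : ∀ i j, Γ.Adj i j ↔ R i j = true) (z : Fin k)
    (h : ∀ i, i ≠ z → ∃ a b, R i a = true ∧ R i b = true ∧ a ≠ b) :
    ¬ Nonempty (BGraph n ≃g Γ) := by
  rintro ⟨e⟩
  have hz : ∀ x : Fin 3, x ≠ 1 → e (Sum.inr (⟨0, by omega⟩, x)) = z := by
    intro x hx
    by_contra hne
    obtain ⟨a, b, ha, hb, hab⟩ := h _ hne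
    have key : ∀ c, R (e (Sum.inr (⟨0, by omega⟩, x))) c = true →
        e.symm c = Sum.inr (⟨0, by omega⟩, 1) := by
      intro c hc
      rw [← BGraph_adj_inr_end _ hx, ← e.map_adj_iff, hR]
      simpa using hc
    exact hab (e.symm.injective ((key a ha).trans (key b hb).symm))
  have := e.injective ((hz 0 (by decide)).trans (hz 2 (by decide)).symm)
  simp at this

theorem isSGraph_BGraph_iff : IsSGraph (BGraph n) ↔ n = 3 ∨ n = 4 := by
  constructor
  · have hcard : ∀ {k : ℕ} {Γ : SimpleGraph (Fin k)}, (BGraph n ≃g Γ) → n = k := by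
      intro k Γ e
      have := Fintype.card_congr e.toEquiv
      rwa [card_BVert, Fintype.card_fin] at this
    rintro (⟨⟨e⟩⟩ | ⟨⟨e⟩⟩ | ⟨⟨e⟩⟩ | ⟨⟨e⟩⟩ | ⟨⟨e⟩⟩ | ⟨⟨e⟩⟩)
    · exact Or.inl (hcard e)
    · exact Or.inl (hcard e)
    · exact Or.inr (hcard e)
    · have := hcard e
      exact (not_nonempty_iso_BGraph (by omega) cycleGraph_six_adj 0 (by decide) ⟨e⟩).elim
    · have := hcard e
      exact (not_nonempty_iso_BGraph (by omega) C6'_adj 6 (by decide) ⟨e⟩).elim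
    · have := hcard e
      exact (not_nonempty_iso_BGraph (by omega) C6''_adj 6 (by decide) ⟨e⟩).elim
  · rintro (rfl | rfl)
    · exact isSGraph_BGraph_three
    · exact isSGraph_BGraph_four

/-- The ends of the paths Fᵢ suffice; the exact number of leaves is not needed for the bound. -/
theorem two_mul_le_leafCount_BGraph (n : ℕ) : 2 * (n / 4) ≤ leafCount (BGraph n) := by
  rw [leafCount_eq]
  have hinj : Function.Injective fun p : Fin (n / 4) × Fin 2 =>
      (Sum.inr (p.1, ![0, 2] p.2) : BVert n) := by
    rintro ⟨m, c⟩ ⟨l, d⟩ h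
    simp only [Sum.inr.injEq, Prod.mk.injEq] at h
    obtain ⟨rfl, h⟩ := h
    congr 1
    clear * - h
    revert c d
    decide
  have hcard := Finset.card_image_of_injective Finset.univ hinj
  rw [Finset.card_univ, Fintype.card_prod, Fintype.card_fin, Fintype.card_fin] at hcard
  rw [mul_comm, ← hcard]
  refine Finset.card_le_card fun v hv => ?_
  obtain ⟨⟨m, c⟩, -, rfl⟩ := Finset.mem_image.1 hv
  rw [Finset.mem_filter, ← SimpleGraph.card_neighborFinset_eq_degree, Finset.card_eq_one]
  refine ⟨Finset.mem_univ _, Sum.inr (m, 1), ?_⟩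
  ext w
  rw [SimpleGraph.mem_neighborFinset, BGraph_adj_inr_end m (by fin_cases c <;> simp),
    Finset.mem_singleton]

/-- The index of the part of `B'ₙ` containing a vertex: the base vertex `i` belongs with `Fᵢ`. -/
def BGraph.column : BVert n → ℕ
  | Sum.inl i => i
  | Sum.inr (m, _) => m

/-- Any vertex dominating part of Fᵢ lies in column i, and each of the ⌊n/4⌋ paths Fᵢ must be hit.
-/
theorem le_isolationNumber_BGraph (n : ℕ) : n / 4 ≤ isolationNumber 2 (BGraph n) := by
  obtain ⟨D, hD, hcard⟩ := exists_isIsolating_card_eq 2 (BGraph n)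
  have hD := isolates_of_isIsolating hD
  have hcol : ∀ (m : Fin (n / 4)) (x : Fin 3), Dominates (BGraph n) D (Sum.inr (m, x)) →
      (m : ℕ) ∈ D.image BGraph.column := by
    rintro m x ⟨d, hd, h⟩
    refine Finset.mem_image.2 ⟨d, hd, ?_⟩
    rcases h with rfl | h
    · rfl
    · rw [BGraph_adj] at h
      rcases d with i | ⟨l, y⟩
      · obtain ⟨-, h | h⟩ := h
        · exact h.1
        · exact h.elim
      · obtain ⟨-, h | h⟩ := h
        · exact congrArg Fin.val h.1
        · exact congrArg Fin.val h.1.symm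
  have hsub : Finset.range (n / 4) ⊆ D.image BGraph.column := by
    intro m hm
    rw [Finset.mem_range] at hm
    have h0 := (BGraph_adj_inr_end (n := n) ⟨m, hm⟩ (x := 0) (by decide) _).2 rfl
    have h2 := ((BGraph_adj_inr_end (n := n) ⟨m, hm⟩ (x := 2) (by decide) _).2 rfl).symm
    rcases hD _ (Finset.mem_univ _) _ (Finset.mem_univ _) _ (Finset.mem_univ _) (by simp) h0 h2
      with h | h | h <;> exact hcol ⟨m, hm⟩ _ h
  have := (Finset.card_le_card hsub).trans Finset.card_image_le
  rwa [Finset.card_range, hcard] at this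

theorem isolationNumber_BGraph (hn : 1 ≤ n) (hS : ¬ IsSGraph (BGraph n)) :
    (isolationNumber 2 (BGraph n) : ℤ) =
      ⌊(4 * (n : ℚ) - (leafCount (BGraph n) : ℚ)) / 14⌋ := by
  have h1 := isolationNumber_two_le (BGraph n) (BGraph_connected hn) hS
  rw [card_BVert] at h1
  refine le_antisymm h1 ?_
  have h2 := le_isolationNumber_BGraph n
  have h3 := two_mul_le_leafCount_BGraph n
  rw [Int.floor_le_iff, div_lt_iff₀ (by norm_num), sub_lt_iff_lt_add]
  -- With a = ⌊n/4⌋ one has n ≤ 4a + 3, hence 4n - 2a ≤ 14a + 12 < 14(a + 1).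
  have h4 : 4 * n < (isolationNumber 2 (BGraph n) + 1) * 14 + leafCount (BGraph n) := by omega
  exact_mod_cast h4

end Extremal

end GraphIsolation

theorem theorem3 :
    (∀ (V : Type*) [Fintype V] (G : SimpleGraph V),
      G.Connected → ¬ GraphIsolation.IsSGraph G →
        (GraphIsolation.isolationNumber 2 G : ℤ) ≤
          ⌊(4 * (Fintype.card V : ℚ) - (GraphIsolation.leafCount G : ℚ)) / 14⌋) ∧
    (∀ n : ℕ, 1 ≤ n →
      (GraphIsolation.BGraph n).Connected ∧
      (GraphIsolation.IsSGraph (GraphIsolation.BGraph n) ↔ n = 3 ∨ n = 4) ∧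
      (¬ GraphIsolation.IsSGraph (GraphIsolation.BGraph n) →
        (GraphIsolation.isolationNumber 2 (GraphIsolation.BGraph n) : ℤ) =
          ⌊(4 * (n : ℚ) - (GraphIsolation.leafCount (GraphIsolation.BGraph n) : ℚ)) / 14⌋)) := by
  exact ⟨fun _ _ G hG hS => GraphIsolation.isolationNumber_two_le G hG hS, fun _ hn =>
    ⟨GraphIsolation.BGraph_connected hn, GraphIsolation.isSGraph_BGraph_iff,
      GraphIsolation.isolationNumber_BGraph hn⟩⟩
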